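/- Let $0\le k\le 3$, let $C\subset\mathbb{R}^k$ be compact and convex, and let $f,g:C\to\mathbb{R}$ be bounded and Lebesgue measurable. For $z\in C$ put $$(f*g)(z)=\sup\Big\{\tfrac{f(x)+g(y)}{2} : x,y\in C,\ \tfrac{x+y}{2}=z\Big\},$$ and let $\operatorname{co}(f)$ be the upper convex hull of $f$, that is, the pointwise infimum of all concave functions $h:C\to\mathbb{R}$ with $h\ge f$. Then $\operatorname{co}(f)-f$ is integrable on $C$ and $$\int_C^{*} \Big((f*g)(x)-\frac{f(x)+g(x)}{2}\Big)\,dx\ \ge\ \frac{k+1}{2^{k+1}}\int_C \big(\operatorname{co}(f)(x)-f(x)\big)\,dx ,$$ where $\int_C^{*}$ is the upper Lebesgue integral (the infimum of the integrals over $C$ of the integrable functions that are at least the integrand on $C$; it is used because $f*g$ need not be measurable). The constant is sharp for $1\le k\le 3$: if $C$ is any nondegenerate $k$-simplex in $\mathbb{R}^k$ and $f=g$ is the indicator function of its set of vertices, then equality holds, and $\int_C (\operatorname{co}(f)-f)\,dx>0$. -/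

import Mathlib

open MeasureTheory Set

/-- The sup-convolution of `f` and `g` on the domain `C`:
`(f * g)(z) = sup { (f x + g y) / 2 : x, y ∈ C, (x + y) / 2 = z }`.
Only the values of `f` and `g` on `C` are used. -/
noncomputable def supConv {E : Type*} [AddCommGroup E] [Module ℝ E]
    (C : Set E) (f g : E → ℝ) (z : E) : ℝ :=
  sSup {r : ℝ | ∃ x ∈ C, ∃ y ∈ C, (1 / 2 : ℝ) • (x + y) = z ∧ r = (f x + g y) / 2}

/-- The upper convex hull `co(f)` of `f` on `C`: the pointwise infimum of all functions that are
concave on `C` and at least `f` on `C`. -/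
noncomputable def upperHull {E : Type*} [AddCommGroup E] [Module ℝ E]
    (C : Set E) (f : E → ℝ) (x : E) : ℝ :=
  sInf {r : ℝ | ∃ h : E → ℝ, ConcaveOn ℝ C h ∧ (∀ y ∈ C, f y ≤ h y) ∧ r = h x}

/-- The upper Lebesgue integral over `C` of a (possibly non-measurable) bounded function `h`:
the infimum of the integrals of the integrable functions that are at least `h` on `C`. -/
noncomputable def upperIntegral {E : Type*} [MeasureSpace E] (C : Set E) (h : E → ℝ) : ℝ :=
  sInf {I : ℝ | ∃ φ : E → ℝ, IntegrableOn φ C ∧ (∀ x ∈ C, h x ≤ φ x) ∧ I = ∫ x in C, φ x}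

/-- The indicator function of the set of vertices of a simplex. -/
noncomputable def vertexIndicator {k : ℕ}
    (T : Affine.Simplex ℝ (EuclideanSpace ℝ (Fin k)) k) : EuclideanSpace ℝ (Fin k) → ℝ :=
  (range T.points).indicator (fun _ => 1)

/-! ### Affine changes of variables and dissections up to null sets -/

section Dissection

variable {E : Type*} [NormedAddCommGroup E] [NormedSpace ℝ E] [FiniteDimensional ℝ E]

/-! The heart is a single simplex `S` on which `co f` is replaced by an affine function `ℓ` that
agrees with `f` at the vertices. Subtracting `ℓ` from `f`, `g` and `f * g` changes neither side, so
take `ℓ = 0`. Dissect `S` into `2 ^ k` pieces of equal volume. On the `k + 1` half-size corner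
copies, pairing a vertex `v` with `y` gives `(f * g)((v + y) / 2) ≥ g y / 2`. The other `m = 2 ^ k -
(k + 1)` pieces are images of midpoint maps `(a_j + b_j) / 2`, where each family of affine maps
pushes uniform measure forward to uniform measure on average, so together they contribute at least
`m (∫ f + ∫ g) / 2`. Only `f` loses mass, at the corners, and this loss is exactly the constant `(k
+ 1) / 2 ^ (k + 1)` (`stdSimplex_supConv_inequality`). Such dissections are exhibited for `k ≤ 3`;
this is the only place where the dimension is restricted.

For general `C`, approximate `co f` from below by the upper hull of finitely many points of the
hypograph (`exists_liftedHull_ge_upperHull_of_isCompact`). Lowering the heights slightly to generic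
ones makes all full-dimensional facets simplices (`exists_isGenericHeight`), and their projections
tile the convex hull of the base points up to a null set. Summing the simplex inequality over the
facets gives `polyhedral_supConv_inequality`; the approximation errors then tend to zero. Every
integrable majorant of the integrand can stand in for it throughout, which handles the possible
non-measurability of `f * g`.

For the vertex indicator of a simplex, `co f = 1`, while `f * f` is almost everywhere `1 / 2` on the
corner copies and `0` elsewhere, so nothing is lost. -/

theorem AffineMap.hasFDerivAt_of_finiteDimensional (α : E →ᵃ[ℝ] E) (x : E) :
    HasFDerivAt α (LinearMap.toContinuousLinearMap α.linear) x := by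
  rw [α.decomp]
  exact (LinearMap.toContinuousLinearMap α.linear).hasFDerivAt.add_const (α 0)

theorem AffineMap.injective_of_det_ne_zero (α : E →ᵃ[ℝ] E)
    (h : LinearMap.det α.linear ≠ 0) : Function.Injective α := by
  rw [← α.linear_injective_iff]
  exact (LinearEquiv.ofIsUnitDet (f := α.linear) (v := Module.finBasis ℝ E)
    (v' := Module.finBasis ℝ E) (by simpa using h)).injective

variable [MeasurableSpace E] [BorelSpace E] (μ : Measure E) [μ.IsAddHaarMeasure]

theorem setIntegral_image_affineMap (α : E →ᵃ[ℝ] E) (h : LinearMap.det α.linear ≠ 0)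
    {S : Set E} (hS : MeasurableSet S) (φ : E → ℝ) :
    ∫ x in α '' S, φ x ∂μ = |LinearMap.det α.linear| * ∫ x in S, φ (α x) ∂μ := by
  rw [integral_image_eq_integral_abs_det_fderiv_smul μ hS
    (fun x _ => (α.hasFDerivAt_of_finiteDimensional x).hasFDerivWithinAt)
    (α.injective_of_det_ne_zero h).injOn, ← integral_const_mul]
  simp [LinearMap.det_toContinuousLinearMap]

theorem integrableOn_image_affineMap (α : E →ᵃ[ℝ] E) (h : LinearMap.det α.linear ≠ 0)
    {S : Set E} (hS : MeasurableSet S) (φ : E → ℝ) :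
    IntegrableOn φ (α '' S) μ ↔ IntegrableOn (fun x => φ (α x)) S μ := by
  rw [integrableOn_image_iff_integrableOn_abs_det_fderiv_smul μ hS
    (fun x _ => (α.hasFDerivAt_of_finiteDimensional x).hasFDerivWithinAt)
    (α.injective_of_det_ne_zero h).injOn]
  simp only [LinearMap.det_toContinuousLinearMap, smul_eq_mul]
  exact integrable_const_mul_iff (by simpa using h) _

theorem measurableSet_image_affineMap (α : E →ᵃ[ℝ] E) (h : LinearMap.det α.linear ≠ 0)
    {S : Set E} (hS : MeasurableSet S) : MeasurableSet (α '' S) :=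
  hS.image_of_continuousOn_injOn α.continuous_of_finiteDimensional.continuousOn
    (α.injective_of_det_ne_zero h).injOn

/-- Disjoint affine copies of `S` inside `S` whose determinants have absolute values summing to `1`
dissect `S` up to a null set. -/
theorem setIntegral_eq_sum_of_dissection {ι : Type*} [Fintype ι] (α : ι → E →ᵃ[ℝ] E) {S : Set E}
    (hS : MeasurableSet S) (hfin : μ S ≠ ⊤) (hmap : ∀ i, MapsTo (α i) S S)
    (hdet : ∀ i, LinearMap.det (α i).linear ≠ 0)
    (hdisj : Pairwise (fun i j => Disjoint (α i '' S) (α j '' S)))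
    (hsum : ∑ i, |LinearMap.det (α i).linear| = 1) {φ : E → ℝ} (hφ : IntegrableOn φ S μ) :
    ∫ x in S, φ x ∂μ = ∑ i, |LinearMap.det (α i).linear| * ∫ x in S, φ (α i x) ∂μ := by
  have hmeas : ∀ i, MeasurableSet (α i '' S) :=
    fun i => measurableSet_image_affineMap (α i) (hdet i) hS
  have hsub : (⋃ i, α i '' S) ⊆ S := iUnion_subset fun i => (hmap i).image_subset
  -- Disjoint copies of total measure `μ S` inside the finite-measure set `S` must fill it almost
  -- everywhere.
  have hvol : μ (⋃ i, α i '' S) = μ S := by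
    rw [measure_iUnion hdisj hmeas, tsum_fintype]
    have : ∀ i, μ (α i '' S) = ENNReal.ofReal |LinearMap.det (α i).linear| * μ S := by
      intro i
      have h1 : α i '' S = (fun x => x + α i 0) '' ((α i).linear '' S) := by
        rw [image_image]
        exact image_congr fun x _ => congrFun (α i).decomp x
      rw [h1, image_add_right, measure_preimage_add_right, Measure.addHaar_image_linearMap]
    simp_rw [this]
    rw [← Finset.sum_mul, ← ENNReal.ofReal_sum_of_nonneg (fun _ _ => abs_nonneg _), hsum]
    simp
  have hae : (⋃ i, α i '' S) =ᵐ[μ] S :=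
    ae_eq_of_subset_of_measure_ge hsub hvol.ge (MeasurableSet.iUnion hmeas).nullMeasurableSet hfin
  rw [← setIntegral_congr_set hae, integral_iUnion_fintype hmeas hdisj
    (fun i => hφ.mono_set (hmap i).image_subset)]
  exact Finset.sum_congr rfl fun i _ => setIntegral_image_affineMap μ (α i) (hdet i) hS φ

end Dissection

/-! ### Affine maps given by matrices -/

section AffineOf

variable {k : ℕ}

/-- The affine self-map `u ↦ M u + b` of Euclidean space. -/
noncomputable def affineOf (M : Matrix (Fin k) (Fin k) ℝ) (b : Fin k → ℝ) :
    EuclideanSpace ℝ (Fin k) →ᵃ[ℝ] EuclideanSpace ℝ (Fin k) :=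
  (Matrix.toEuclideanLin M).toAffineMap + AffineMap.const ℝ _ (WithLp.toLp 2 b)

theorem affineOf_apply (M : Matrix (Fin k) (Fin k) ℝ) (b : Fin k → ℝ)
    (u : EuclideanSpace ℝ (Fin k)) (i : Fin k) :
    affineOf M b u i = ∑ j, M i j * u j + b i := by
  simp [affineOf, Matrix.mulVec, dotProduct]

theorem det_affineOf (M : Matrix (Fin k) (Fin k) ℝ) (b : Fin k → ℝ) :
    LinearMap.det (affineOf M b).linear = M.det := by
  have : (affineOf M b).linear = Matrix.toLpLin 2 2 M := by
    ext; simp [affineOf]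
  rw [this]; simp

end AffineOf

/-! ### The standard simplex, its corner copies, and dissections for `k ≤ 2` -/

section StandardSimplex

/-- The interior of the standard simplex with vertices `0, e₁, …, eₖ`. -/
def openSimplex (k : ℕ) : Set (EuclideanSpace ℝ (Fin k)) :=
  {u | (∀ i, 0 < u i) ∧ ∑ i, u i < 1}

theorem isOpen_openSimplex (k : ℕ) : IsOpen (openSimplex k) := by
  have : openSimplex k = (⋂ i, {u : EuclideanSpace ℝ (Fin k) | 0 < u i}) ∩
      {u : EuclideanSpace ℝ (Fin k) | ∑ i, u i < 1} := by
    ext u; simp [openSimplex]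
  rw [this]
  refine (isOpen_iInter_of_finite fun i => ?_).inter ?_
  · exact isOpen_lt continuous_const (by fun_prop)
  · exact isOpen_lt (by fun_prop) continuous_const

theorem volume_openSimplex_ne_top (k : ℕ) : volume (openSimplex k) ≠ ⊤ := by
  have hsub : openSimplex k ⊆ WithLp.ofLp ⁻¹' (Icc (0 : Fin k → ℝ) 1) := by
    intro u hu
    refine ⟨fun i => (hu.1 i).le, fun i => ?_⟩
    exact (Finset.single_le_sum (fun j _ => (hu.1 j).le) (Finset.mem_univ i)).trans hu.2.le
  refine ne_top_of_le_ne_top ?_ (measure_mono hsub)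
  have h := (EuclideanSpace.volume_preserving_symm_measurableEquiv_toLp (Fin k)).measure_preimage
    (measurableSet_Icc (a := (0 : Fin k → ℝ)) (b := 1)).nullMeasurableSet
  have h2 : volume (WithLp.ofLp ⁻¹' (Icc (0 : Fin k → ℝ) 1) : Set (EuclideanSpace ℝ (Fin k))) =
      volume (Icc (0 : Fin k → ℝ) 1) := h
  rw [h2]
  exact isCompact_Icc.measure_lt_top.ne

variable {k : ℕ}

/-- The affine map sending the vertices `0, e₁, …, eₖ` of the standard simplex to `a 0, …, a k`. -/
noncomputable def simplexMap (a : Fin (k + 1) → Fin k → ℝ) :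
    EuclideanSpace ℝ (Fin k) →ᵃ[ℝ] EuclideanSpace ℝ (Fin k) :=
  affineOf (Matrix.of fun i j => a j.succ i - a 0 i) (a 0)

theorem simplexMap_apply (a : Fin (k + 1) → Fin k → ℝ) (u : EuclideanSpace ℝ (Fin k))
    (i : Fin k) : simplexMap a u i = ∑ j : Fin k, (a j.succ i - a 0 i) * u j + a 0 i := by
  simp [simplexMap, affineOf_apply]

theorem det_simplexMap (a : Fin (k + 1) → Fin k → ℝ) :
    LinearMap.det (simplexMap a).linear =
      (Matrix.of fun i j : Fin k => a j.succ i - a 0 i).det :=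
  det_affineOf _ _

theorem midpoint_simplexMap (a b : Fin (k + 1) → Fin k → ℝ) (u : EuclideanSpace ℝ (Fin k)) :
    (1 / 2 : ℝ) • (simplexMap a u + simplexMap b u) =
      simplexMap (fun i j => (a i j + b i j) / 2) u := by
  ext i
  simp only [PiLp.smul_apply, PiLp.add_apply, simplexMap_apply, smul_eq_mul]
  have : ∀ j : Fin k, ((a j.succ i + b j.succ i) / 2 - (a 0 i + b 0 i) / 2) * u j =
      (1 / 2) * ((a j.succ i - a 0 i) * u j) + (1 / 2) * ((b j.succ i - b 0 i) * u j) := by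
    intro j; ring
  simp_rw [this, Finset.sum_add_distrib, ← Finset.mul_sum]
  ring

/-- The vertices `0, e₁, …, eₖ` of the standard simplex. -/
def stdVertex (k : ℕ) : Fin (k + 1) → Fin k → ℝ :=
  Fin.cons 0 fun i => Pi.single i 1

/-- The barycentric coordinates of the standard simplex. -/
noncomputable def stdCoord (i : Fin (k + 1)) (u : EuclideanSpace ℝ (Fin k)) : ℝ :=
  Fin.cases (1 - ∑ j, u j) (fun j => u j) i

theorem sum_stdCoord (u : EuclideanSpace ℝ (Fin k)) : ∑ i, stdCoord i u = 1 := by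
  simp [Fin.sum_univ_succ, stdCoord]

theorem mem_openSimplex_iff (u : EuclideanSpace ℝ (Fin k)) :
    u ∈ openSimplex k ↔ ∀ i, 0 < stdCoord i u := by
  rw [Fin.forall_fin_succ]
  simp [openSimplex, stdCoord, and_comm]

/-- The homothety with ratio `1/2` centred at a vertex of the standard simplex. -/
noncomputable def vertexMap (i : Fin (k + 1)) :
    EuclideanSpace ℝ (Fin k) →ᵃ[ℝ] EuclideanSpace ℝ (Fin k) :=
  affineOf ((1 / 2 : ℝ) • (1 : Matrix (Fin k) (Fin k) ℝ)) fun j => stdVertex k i j / 2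

theorem vertexMap_apply (i : Fin (k + 1)) (u : EuclideanSpace ℝ (Fin k)) :
    vertexMap i u = (1 / 2 : ℝ) • (WithLp.toLp 2 (stdVertex k i) + u) := by
  ext j
  simp [vertexMap, affineOf_apply, Matrix.one_apply]
  ring

theorem det_vertexMap (i : Fin (k + 1)) :
    LinearMap.det (vertexMap i).linear = (1 / 2 : ℝ) ^ k := by
  rw [vertexMap, det_affineOf, Matrix.det_smul]
  simp

theorem stdCoord_stdVertex (i j : Fin (k + 1)) :
    stdCoord j (WithLp.toLp 2 (stdVertex k i)) = if j = i then 1 else 0 := by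
  induction i using Fin.cases with
  | zero =>
    induction j using Fin.cases with
    | zero => simp [stdCoord, stdVertex]
    | succ j => simp [stdCoord, stdVertex, Fin.succ_ne_zero]
  | succ i =>
    induction j using Fin.cases with
    | zero => simp [stdCoord, stdVertex, (Fin.succ_ne_zero i).symm]
    | succ j => simp [stdCoord, stdVertex, Pi.single_apply]

theorem stdCoord_midpoint (j : Fin (k + 1)) (u v : EuclideanSpace ℝ (Fin k)) :
    stdCoord j ((1 / 2 : ℝ) • (u + v)) = (stdCoord j u + stdCoord j v) / 2 := by
  induction j using Fin.cases with
  | zero =>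
    simp only [stdCoord, Fin.cases_zero, PiLp.smul_apply, PiLp.add_apply, smul_eq_mul,
      ← Finset.mul_sum, Finset.sum_add_distrib]
    ring
  | succ j => simp [stdCoord]; ring

theorem stdCoord_vertexMap (i j : Fin (k + 1)) (u : EuclideanSpace ℝ (Fin k)) :
    stdCoord j (vertexMap i u) = ((if j = i then 1 else 0) + stdCoord j u) / 2 := by
  rw [vertexMap_apply, stdCoord_midpoint, stdCoord_stdVertex]

theorem vertexMap_mapsTo (i : Fin (k + 1)) :
    MapsTo (vertexMap i) (openSimplex k) (openSimplex k) := by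
  intro u hu
  rw [mem_openSimplex_iff] at hu ⊢
  intro j
  rw [stdCoord_vertexMap]
  have := hu j
  split_ifs <;> linarith

theorem half_lt_stdCoord_vertexMap (i : Fin (k + 1)) {u : EuclideanSpace ℝ (Fin k)}
    (hu : u ∈ openSimplex k) : 1 / 2 < stdCoord i (vertexMap i u) := by
  rw [stdCoord_vertexMap, if_pos rfl]
  have := (mem_openSimplex_iff u).1 hu i
  linarith

/-- In the corner at a vertex its barycentric coordinate exceeds `1 / 2`; two nonnegative
coordinates with sum at most `1` cannot both do so. -/
theorem disjoint_vertexMap {i j : Fin (k + 1)} (hij : i ≠ j) :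
    Disjoint (vertexMap i '' openSimplex k) (vertexMap j '' openSimplex k) := by
  rw [Set.disjoint_left]
  rintro _ ⟨u, hu, rfl⟩ ⟨w, hw, h⟩
  have h1 := half_lt_stdCoord_vertexMap i hu
  have h2 := half_lt_stdCoord_vertexMap j hw
  have h3 := (mem_openSimplex_iff _).1 (vertexMap_mapsTo i hu)
  rw [h] at h2
  have h4 : stdCoord i (vertexMap i u) + stdCoord j (vertexMap i u) ≤
      ∑ l, stdCoord l (vertexMap i u) := by
    rw [← Finset.sum_pair (f := fun l => stdCoord l (vertexMap i u)) hij]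
    exact Finset.sum_le_sum_of_subset_of_nonneg (Finset.subset_univ _) fun l _ _ => (h3 l).le
  rw [sum_stdCoord] at h4
  linarith

/-- The affine maps `simplexMap (a j)`, `j < m`, push the uniform measure of the standard simplex
forward to measures with uniform average. -/
def AveragesToUniform {m : ℕ} (a : Fin m → Fin (k + 1) → Fin k → ℝ) : Prop :=
  (∀ j, MapsTo (simplexMap (a j)) (openSimplex k) (openSimplex k)) ∧
  ∀ φ : EuclideanSpace ℝ (Fin k) → ℝ, IntegrableOn φ (openSimplex k) →
    (∀ j, IntegrableOn (fun u => φ (simplexMap (a j) u)) (openSimplex k)) ∧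
    ∑ j, ∫ u in openSimplex k, φ (simplexMap (a j) u) = m * ∫ u in openSimplex k, φ u

/-- The part of the standard simplex away from its vertices is dissected by the midpoint maps of
pairs of affine maps each of which averages to the uniform measure. -/
def HasMidpointDissection (k : ℕ) : Prop :=
  ∃ (m : ℕ) (a b : Fin m → Fin (k + 1) → Fin k → ℝ), m + (k + 1) = 2 ^ k ∧
    AveragesToUniform a ∧ AveragesToUniform b ∧
    (∀ j, |LinearMap.det (simplexMap fun i l => (a j i l + b j i l) / 2).linear| =
      (1 / 2 : ℝ) ^ k) ∧
    (Pairwise fun j j' => Disjoint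
      (simplexMap (fun i l => (a j i l + b j i l) / 2) '' openSimplex k)
      (simplexMap (fun i l => (a j' i l + b j' i l) / 2) '' openSimplex k)) ∧
    ∀ j, ∀ u ∈ openSimplex k, ∀ i,
      stdCoord i (simplexMap (fun i l => (a j i l + b j i l) / 2) u) ≤ 1 / 2

theorem averagesToUniform_fin_zero (a : Fin 0 → Fin (k + 1) → Fin k → ℝ) :
    AveragesToUniform a :=
  ⟨fun j => j.elim0, fun φ _ => ⟨fun j => j.elim0, by simp⟩⟩

/-- For `k = 0` and `k = 1` the corners alone already fill the simplex, since `k + 1 = 2 ^ k`; hence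
`m = 0`. -/
theorem hasMidpointDissection_zero : HasMidpointDissection 0 :=
  ⟨0, Fin.elim0, Fin.elim0, by norm_num, averagesToUniform_fin_zero _,
    averagesToUniform_fin_zero _, fun j => j.elim0, fun j => j.elim0, fun j => j.elim0⟩

theorem hasMidpointDissection_one : HasMidpointDissection 1 :=
  ⟨0, Fin.elim0, Fin.elim0, by norm_num, averagesToUniform_fin_zero _,
    averagesToUniform_fin_zero _, fun j => j.elim0, fun j => j.elim0, fun j => j.elim0⟩

/-- `m` disjoint affine copies of the standard simplex inside itself, each with volume ratio `1/m`,
average to the uniform measure. -/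
theorem averagesToUniform_of_disjoint {m : ℕ} (hm : 0 < m)
    (a : Fin m → Fin (k + 1) → Fin k → ℝ)
    (hmap : ∀ j, MapsTo (simplexMap (a j)) (openSimplex k) (openSimplex k))
    (hdet : ∀ j, |LinearMap.det (simplexMap (a j)).linear| = 1 / (m : ℝ))
    (hdisj : Pairwise fun i j =>
      Disjoint (simplexMap (a i) '' openSimplex k) (simplexMap (a j) '' openSimplex k)) :
    AveragesToUniform a := by
  have hm' : (m : ℝ) ≠ 0 := by positivity
  have hne : ∀ j, LinearMap.det (simplexMap (a j)).linear ≠ 0 := fun j => by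
    rw [← abs_ne_zero, hdet]; positivity
  have hS := (isOpen_openSimplex k).measurableSet
  refine ⟨hmap, fun φ hφ => ⟨fun j => ?_, ?_⟩⟩
  · rw [← integrableOn_image_affineMap volume _ (hne j) hS]
    exact hφ.mono_set (hmap j).image_subset
  · rw [setIntegral_eq_sum_of_dissection volume (fun j => simplexMap (a j)) hS
      (volume_openSimplex_ne_top k) hmap hne hdisj (by simp [hdet, hm']) hφ]
    simp_rw [hdet, Finset.mul_sum, ← mul_assoc]
    simp [hm']

/-- What remains of a triangle is the medial triangle. It is the image of the average of the
identity and the cyclic rotation of the vertices, both of which preserve area. -/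
theorem hasMidpointDissection_two : HasMidpointDissection 2 := by
  refine ⟨1, ![![![0, 0], ![1, 0], ![0, 1]]], ![![![1, 0], ![0, 1], ![0, 0]]], by norm_num,
    averagesToUniform_of_disjoint one_pos _ ?_ ?_ (Subsingleton.pairwise),
    averagesToUniform_of_disjoint one_pos _ ?_ ?_ (Subsingleton.pairwise), ?_,
    (Subsingleton.pairwise), ?_⟩
  · simp [Fin.forall_fin_succ, MapsTo, openSimplex, simplexMap_apply, Fin.sum_univ_succ]
  · simp [det_simplexMap, Matrix.det_fin_two]
  · simp [Fin.forall_fin_succ, MapsTo, openSimplex, simplexMap_apply, Fin.sum_univ_succ]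
    intros; and_intros <;> linarith
  · simp [det_simplexMap, Matrix.det_fin_two]
  · simp [det_simplexMap, Matrix.det_fin_two]; norm_num [abs_of_pos]
  · simp [Fin.forall_fin_succ, openSimplex, simplexMap_apply, Fin.sum_univ_succ, stdCoord]
    intros; and_intros <;> linarith

end StandardSimplex

/-! ### Dissection of the central octahedron for `k = 3` -/

section ThreeDimensional

theorem AveragesToUniform.append {k : ℕ} {a₀ a₁ a₂ a₃ : Fin (k + 1) → Fin k → ℝ}
    (h : AveragesToUniform ![a₀, a₁]) (h' : AveragesToUniform ![a₂, a₃]) :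
    AveragesToUniform ![a₀, a₁, a₂, a₃] := by
  refine ⟨?_, fun φ hφ => ⟨?_, ?_⟩⟩
  · have h1 := h.1; have h2 := h'.1
    simp only [Fin.forall_fin_succ] at h1 h2 ⊢
    simp_all
  · have h1 := (h.2 φ hφ).1; have h2 := (h'.2 φ hφ).1
    simp only [Fin.forall_fin_succ] at h1 h2 ⊢
    simp_all
  · have h1 := (h.2 φ hφ).2; have h2 := (h'.2 φ hφ).2
    simp [Fin.sum_univ_succ] at h1 h2 ⊢
    linarith

/-- The plane through the edge `0 e₁` and the midpoint of `e₂ e₃` halves the tetrahedron; the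
"upper" variants exchange the two opposite edges. The "right" families use the same halves with the
vertices listed in another order, chosen so that vertexwise averages with the "left" ones are edge
midpoints. -/
theorem averagesToUniform_tetrahedra_left_lower :
    AveragesToUniform ![![![1, 0, 0], ![0, 0, 0], ![0, 1, 0], ![0, 1 / 2, 1 / 2]],
      ![![1, 0, 0], ![0, 0, 0], ![0, 0, 1], ![0, 1 / 2, 1 / 2]]] := by
  refine averagesToUniform_of_disjoint two_pos _ ?_ ?_ ?_
  · simp [Fin.forall_fin_succ, MapsTo, openSimplex, simplexMap_apply, Fin.sum_univ_succ]
    and_intros <;> intros <;> and_intros <;> linarith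
  · simp [det_simplexMap, Matrix.det_fin_three]
  · simp only [Pairwise, Set.disjoint_left]
    simp [openSimplex, PiLp.ext_iff, simplexMap_apply, Fin.sum_univ_succ, Fin.forall_fin_succ]
    and_intros <;> intros <;> linarith

theorem averagesToUniform_tetrahedra_left_upper :
    AveragesToUniform ![![![0, 0, 1], ![0, 1, 0], ![0, 0, 0], ![1 / 2, 0, 0]],
      ![![0, 0, 1], ![0, 1, 0], ![1, 0, 0], ![1 / 2, 0, 0]]] := by
  refine averagesToUniform_of_disjoint two_pos _ ?_ ?_ ?_
  · simp [Fin.forall_fin_succ, MapsTo, openSimplex, simplexMap_apply, Fin.sum_univ_succ]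
    and_intros <;> intros <;> and_intros <;> linarith
  · simp [det_simplexMap, Matrix.det_fin_three]
    norm_num [abs_of_pos]
  · simp only [Pairwise, Set.disjoint_left]
    simp [openSimplex, PiLp.ext_iff, simplexMap_apply, Fin.sum_univ_succ, Fin.forall_fin_succ]
    and_intros <;> intros <;> linarith

theorem averagesToUniform_tetrahedra_right_lower :
    AveragesToUniform ![![![0, 0, 0], ![0, 1, 0], ![1, 0, 0], ![0, 1 / 2, 1 / 2]],
      ![![0, 0, 0], ![0, 0, 1], ![1, 0, 0], ![0, 1 / 2, 1 / 2]]] := by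
  refine averagesToUniform_of_disjoint two_pos _ ?_ ?_ ?_
  · simp [Fin.forall_fin_succ, MapsTo, openSimplex, simplexMap_apply, Fin.sum_univ_succ]
    and_intros <;> intros <;> and_intros <;> linarith
  · simp [det_simplexMap, Matrix.det_fin_three]
  · simp only [Pairwise, Set.disjoint_left]
    simp [openSimplex, PiLp.ext_iff, simplexMap_apply, Fin.sum_univ_succ, Fin.forall_fin_succ]
    and_intros <;> intros <;> linarith

theorem averagesToUniform_tetrahedra_right_upper :
    AveragesToUniform ![![![0, 1, 0], ![0, 0, 0], ![0, 0, 1], ![1 / 2, 0, 0]],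
      ![![0, 1, 0], ![1, 0, 0], ![0, 0, 1], ![1 / 2, 0, 0]]] := by
  refine averagesToUniform_of_disjoint two_pos _ ?_ ?_ ?_
  · simp [Fin.forall_fin_succ, MapsTo, openSimplex, simplexMap_apply, Fin.sum_univ_succ]
    and_intros <;> intros <;> and_intros <;> linarith
  · simp [det_simplexMap, Matrix.det_fin_three]
    norm_num [abs_of_pos]
  · simp only [Pairwise, Set.disjoint_left]
    simp [openSimplex, PiLp.ext_iff, simplexMap_apply, Fin.sum_univ_succ, Fin.forall_fin_succ]
    and_intros <;> intros <;> linarith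

/-- The four regions into which the planes `z₂ - z₃ = ± (z₁ - z₀)` cut the standard simplex, in
barycentric coordinates. -/
def octahedronRegion : Fin 4 → Set (EuclideanSpace ℝ (Fin 3)) :=
  ![{u | |2 * u 0 + u 1 + u 2 - 1| < u 1 - u 2}, {u | |2 * u 0 + u 1 + u 2 - 1| < u 2 - u 1},
    {u | |u 1 - u 2| < 1 - 2 * u 0 - u 1 - u 2}, {u | |u 1 - u 2| < 2 * u 0 + u 1 + u 2 - 1}]

theorem disjoint_octahedronRegion {i j : Fin 4} (hij : i ≠ j) :
    Disjoint (octahedronRegion i) (octahedronRegion j) := by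
  rw [Set.disjoint_left]
  fin_cases i <;> fin_cases j <;> first
    | exact absurd rfl hij
    | (simp only [octahedronRegion, abs_lt]
       simp
       intros
       linarith)

/-- The midpoint maps yield the four tetrahedra around the diagonal of the octahedron from `e₁ / 2`
to `(e₂ + e₃) / 2`, each of volume ratio `1 / 8`. -/
theorem hasMidpointDissection_three : HasMidpointDissection 3 := by
  -- Both cutting planes contain that diagonal, so each tetrahedron falls in its own region; this
  -- gives disjointness.
  have hreg : ∀ j, ∀ u ∈ openSimplex 3,
      simplexMap (fun i l => ((![![![1, 0, 0], ![0, 0, 0], ![0, 1, 0], ![0, 1 / 2, 1 / 2]],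
      ![![1, 0, 0], ![0, 0, 0], ![0, 0, 1], ![0, 1 / 2, 1 / 2]],
      ![![0, 0, 1], ![0, 1, 0], ![0, 0, 0], ![1 / 2, 0, 0]],
      ![![0, 0, 1], ![0, 1, 0], ![1, 0, 0], ![1 / 2, 0, 0]]] : Fin 4 → Fin 4 → Fin 3 → ℝ) j i l +
        (![![![0, 0, 0], ![0, 1, 0], ![1, 0, 0], ![0, 1 / 2, 1 / 2]],
      ![![0, 0, 0], ![0, 0, 1], ![1, 0, 0], ![0, 1 / 2, 1 / 2]],
      ![![0, 1, 0], ![0, 0, 0], ![0, 0, 1], ![1 / 2, 0, 0]],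
      ![![0, 1, 0], ![1, 0, 0], ![0, 0, 1], ![1 / 2, 0, 0]]] : Fin 4 → Fin 4 → Fin 3 → ℝ) j i l) / 2) u ∈
        octahedronRegion j := by
    simp [Fin.forall_fin_succ, openSimplex, simplexMap_apply, Fin.sum_univ_succ, octahedronRegion,
      abs_lt]
    and_intros <;> intros <;> and_intros <;> linarith
  refine ⟨4, ![![![1, 0, 0], ![0, 0, 0], ![0, 1, 0], ![0, 1 / 2, 1 / 2]],
      ![![1, 0, 0], ![0, 0, 0], ![0, 0, 1], ![0, 1 / 2, 1 / 2]],
      ![![0, 0, 1], ![0, 1, 0], ![0, 0, 0], ![1 / 2, 0, 0]],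
      ![![0, 0, 1], ![0, 1, 0], ![1, 0, 0], ![1 / 2, 0, 0]]],
    ![![![0, 0, 0], ![0, 1, 0], ![1, 0, 0], ![0, 1 / 2, 1 / 2]],
      ![![0, 0, 0], ![0, 0, 1], ![1, 0, 0], ![0, 1 / 2, 1 / 2]],
      ![![0, 1, 0], ![0, 0, 0], ![0, 0, 1], ![1 / 2, 0, 0]],
      ![![0, 1, 0], ![1, 0, 0], ![0, 0, 1], ![1 / 2, 0, 0]]], by norm_num,
    averagesToUniform_tetrahedra_left_lower.append averagesToUniform_tetrahedra_left_upper,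
    averagesToUniform_tetrahedra_right_lower.append averagesToUniform_tetrahedra_right_upper,
    ?_, ?_, ?_⟩
  · simp [Fin.forall_fin_succ, det_simplexMap, Matrix.det_fin_three]
    norm_num [abs_of_pos, abs_of_neg]
  · intro i j hij
    refine (disjoint_octahedronRegion hij).mono ?_ ?_
    · exact image_subset_iff.2 (hreg i)
    · exact image_subset_iff.2 (hreg j)
  · simp [Fin.forall_fin_succ, openSimplex, simplexMap_apply, Fin.sum_univ_succ, stdCoord]
    and_intros <;> intros <;> and_intros <;> linarith

theorem hasMidpointDissection_of_le_three {k : ℕ} (hk : k ≤ 3) : HasMidpointDissection k := by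
  interval_cases k
  · exact hasMidpointDissection_zero
  · exact hasMidpointDissection_one
  · exact hasMidpointDissection_two
  · exact hasMidpointDissection_three

end ThreeDimensional

/-! ### The inequality on one simplex -/

section SimplexInequality

variable {k : ℕ}

/-- This is the normalised case `ℓ = 0`. The vertices are not in the open simplex and are invisible
to integrals, so the value `0` there enters through `hvert`. -/
theorem stdSimplex_supConv_inequality (hk : HasMidpointDissection k)
    {f g ψ : EuclideanSpace ℝ (Fin k) → ℝ}
    (hf : IntegrableOn f (openSimplex k)) (hg : IntegrableOn g (openSimplex k))
    (hψ : IntegrableOn ψ (openSimplex k))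
    (hmid : ∀ x ∈ openSimplex k, ∀ y ∈ openSimplex k,
      (f x + g y) / 2 ≤ ψ ((1 / 2 : ℝ) • (x + y)))
    (hvert : ∀ i, ∀ y ∈ openSimplex k,
      g y / 2 ≤ ψ ((1 / 2 : ℝ) • (WithLp.toLp 2 (stdVertex k i) + y))) :
    -(((k : ℝ) + 1) / 2 ^ (k + 1) * ∫ u in openSimplex k, f u) ≤
      (∫ u in openSimplex k, ψ u) -
        ((∫ u in openSimplex k, f u) + ∫ u in openSimplex k, g u) / 2 := by
  obtain ⟨m, a, b, hm, ⟨hamap, ha⟩, ⟨hbmap, hb⟩, hdet, hdisj, hcoord⟩ := hk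
  obtain ⟨haint, hasum⟩ := ha f hf
  obtain ⟨hbint, hbsum⟩ := hb g hg
  have hS := (isOpen_openSimplex k).measurableSet
  have h2k : (0 : ℝ) < 2 ^ k := by positivity
  let Z : Fin m → EuclideanSpace ℝ (Fin k) →ᵃ[ℝ] EuclideanSpace ℝ (Fin k) :=
    fun j => simplexMap fun i l => (a j i l + b j i l) / 2
  have hZ : ∀ j u, Z j u = (1 / 2 : ℝ) • (simplexMap (a j) u + simplexMap (b j) u) :=
    fun j u => (midpoint_simplexMap (a j) (b j) u).symm
  have hZmap : ∀ j, MapsTo (Z j) (openSimplex k) (openSimplex k) := by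
    intro j u hu
    have h1 := hamap j hu
    have h2 := hbmap j hu
    rw [mem_openSimplex_iff] at h1 h2 ⊢
    intro i
    rw [hZ, stdCoord_midpoint]
    linarith [h1 i, h2 i]
  let α : Fin (k + 1) ⊕ Fin m → EuclideanSpace ℝ (Fin k) →ᵃ[ℝ] EuclideanSpace ℝ (Fin k) :=
    Sum.elim vertexMap Z
  have hαdet : ∀ i, |LinearMap.det (α i).linear| = (1 / 2 : ℝ) ^ k := by
    rintro (i | j)
    · simp only [α, Sum.elim_inl, det_vertexMap]
      exact abs_of_pos (by positivity)
    · exact hdet j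
  have hαmap : ∀ i, MapsTo (α i) (openSimplex k) (openSimplex k) := by
    rintro (i | j)
    · exact vertexMap_mapsTo i
    · exact hZmap j
  have hαne : ∀ i, LinearMap.det (α i).linear ≠ 0 := fun i => by
    rw [← abs_ne_zero, hαdet]; positivity
  -- A corner has a coordinate above `1 / 2`; on a midpoint piece all coordinates are at most `1 /
  -- 2`.
  have hcross : ∀ i j, Disjoint (vertexMap i '' openSimplex k) (Z j '' openSimplex k) := by
    intro i j
    rw [Set.disjoint_left]
    rintro _ ⟨u, hu, rfl⟩ ⟨w, hw, h⟩
    have h1 := half_lt_stdCoord_vertexMap i hu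
    have h2 := hcoord j w hw i
    rw [← h] at h1
    exact absurd h1 h2.not_gt
  have hαdisj : Pairwise fun i j =>
      Disjoint (α i '' openSimplex k) (α j '' openSimplex k) := by
    rintro (i | i) (j | j) hij
    · exact disjoint_vertexMap fun h => hij (congrArg _ h)
    · exact hcross i j
    · exact (hcross j i).symm
    · exact hdisj fun h => hij (congrArg _ h)
  have hmr : (m : ℝ) + (k + 1) = 2 ^ k := by exact_mod_cast hm
  have hdiss := setIntegral_eq_sum_of_dissection volume α hS (volume_openSimplex_ne_top k) hαmap
    hαne hαdisj (by
      simp only [hαdet, Finset.sum_const, Finset.card_univ, Fintype.card_sum, Fintype.card_fin,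
        nsmul_eq_mul]
      push_cast
      rw [add_comm, hmr, ← mul_pow]
      norm_num) hψ
  have hψint : ∀ i, IntegrableOn (fun u => ψ (α i u)) (openSimplex k) := fun i => by
    rw [← integrableOn_image_affineMap volume _ (hαne i) hS]
    exact hψ.mono_set (hαmap i).image_subset
  simp_rw [hαdet, ← Finset.mul_sum] at hdiss
  rw [Fintype.sum_sum_type] at hdiss
  have hV : ((k : ℝ) + 1) * ((∫ u in openSimplex k, g u) / 2) ≤
      ∑ i : Fin (k + 1), ∫ u in openSimplex k, ψ (α (Sum.inl i) u) := by
    have : ∀ i : Fin (k + 1), (∫ u in openSimplex k, g u) / 2 ≤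
        ∫ u in openSimplex k, ψ (α (Sum.inl i) u) := by
      intro i
      rw [← integral_div]
      refine setIntegral_mono_on (hg.div_const 2) (hψint _) hS fun u hu => ?_
      simp only [α, Sum.elim_inl, vertexMap_apply]
      exact hvert i u hu
    simpa using Finset.sum_le_sum fun i (_ : i ∈ Finset.univ) => this i
  have hR : (m : ℝ) * (((∫ u in openSimplex k, f u) + ∫ u in openSimplex k, g u) / 2) ≤
      ∑ j : Fin m, ∫ u in openSimplex k, ψ (α (Sum.inr j) u) := by
    have : ∀ j : Fin m, ((∫ u in openSimplex k, f (simplexMap (a j) u)) +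
        ∫ u in openSimplex k, g (simplexMap (b j) u)) / 2 ≤
        ∫ u in openSimplex k, ψ (α (Sum.inr j) u) := by
      intro j
      rw [← integral_add (haint j) (hbint j), ← integral_div]
      refine setIntegral_mono_on (((haint j).add (hbint j)).div_const 2) (hψint _) hS
        fun u hu => ?_
      simp only [α, Sum.elim_inr, hZ]
      exact hmid _ (hamap j hu) _ (hbmap j hu)
    refine le_trans (le_of_eq ?_) (Finset.sum_le_sum fun j (_ : j ∈ Finset.univ) => this j)
    rw [← Finset.sum_div, Finset.sum_add_distrib, hasum, hbsum]
    ring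
  have hmr' : (m : ℝ) = 2 ^ k - (k + 1) := by linarith
  rw [hmr'] at hR
  rw [hdiss]
  set F := ∫ u in openSimplex k, f u
  set G := ∫ u in openSimplex k, g u
  -- The corners contribute `G / 2` in place of `(F + G) / 2`; the deficit `F / 2` on each of `k +
  -- 1` pieces of weight `2⁻ᵏ` is the constant of the theorem.
  have key : (1 / 2 : ℝ) ^ k * (((k : ℝ) + 1) * (G / 2) + (2 ^ k - (k + 1)) * ((F + G) / 2)) =
      (F + G) / 2 - ((k : ℝ) + 1) / 2 ^ (k + 1) * F := by
    rw [one_div, inv_pow, pow_succ]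
    field_simp
    ring
  have := mul_le_mul_of_nonneg_left (add_le_add hV hR) (by positivity : (0 : ℝ) ≤ (1 / 2) ^ k)
  rw [key] at this
  linarith

/-- An affine `ℓ` commutes with midpoints, so subtracting it preserves `hmid` and turns `hvert` into
the normalised form; the map `A` multiplies both sides by `|det A|`. -/
theorem simplex_supConv_inequality (hk : HasMidpointDissection k)
    (A : EuclideanSpace ℝ (Fin k) →ᵃ[ℝ] EuclideanSpace ℝ (Fin k))
    (hA : LinearMap.det A.linear ≠ 0) (ℓ : EuclideanSpace ℝ (Fin k) →ᵃ[ℝ] ℝ)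
    {f g ψ : EuclideanSpace ℝ (Fin k) → ℝ}
    (hℓ : IntegrableOn ℓ (A '' openSimplex k))
    (hf : IntegrableOn f (A '' openSimplex k)) (hg : IntegrableOn g (A '' openSimplex k))
    (hψ : IntegrableOn ψ (A '' openSimplex k))
    (hmid : ∀ x ∈ A '' openSimplex k, ∀ y ∈ A '' openSimplex k,
      (f x + g y) / 2 ≤ ψ ((1 / 2 : ℝ) • (x + y)))
    (hvert : ∀ i, ∀ y ∈ A '' openSimplex k,
      (ℓ (A (WithLp.toLp 2 (stdVertex k i))) + g y) / 2 ≤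
        ψ ((1 / 2 : ℝ) • (A (WithLp.toLp 2 (stdVertex k i)) + y))) :
    ((k : ℝ) + 1) / 2 ^ (k + 1) * ∫ x in A '' openSimplex k, (ℓ x - f x) ≤
      ∫ x in A '' openSimplex k, (ψ x - (f x + g x) / 2) := by
  have hS := (isOpen_openSimplex k).measurableSet
  have hmidA : ∀ {F : Type} [NormedAddCommGroup F] [NormedSpace ℝ F]
      (B : EuclideanSpace ℝ (Fin k) →ᵃ[ℝ] F) (x y : EuclideanSpace ℝ (Fin k)),
      B ((1 / 2 : ℝ) • (x + y)) = (1 / 2 : ℝ) • (B x + B y) := by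
    intro F _ _ B x y
    have h := B.map_midpoint x y
    rwa [midpoint_eq_smul_add, midpoint_eq_smul_add, invOf_eq_inv, ← one_div] at h
  have hcomp : ∀ {φ : EuclideanSpace ℝ (Fin k) → ℝ}, IntegrableOn φ (A '' openSimplex k) →
      IntegrableOn (fun u => φ (A u)) (openSimplex k) :=
    fun h => (integrableOn_image_affineMap volume A hA hS _).1 h
  have hf' := hcomp hf
  have hg' := hcomp hg
  have hψ' := hcomp hψ
  have hℓ' := hcomp hℓ
  have key := stdSimplex_supConv_inequality hk (f := fun u => f (A u) - ℓ (A u))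
    (g := fun u => g (A u) - ℓ (A u)) (ψ := fun u => ψ (A u) - ℓ (A u))
    (hf'.sub hℓ') (hg'.sub hℓ') (hψ'.sub hℓ') (fun x hx y hy => by
      have h := hmid _ (mem_image_of_mem A hx) _ (mem_image_of_mem A hy)
      rw [hmidA A, hmidA ℓ, smul_eq_mul]
      linarith) (fun i y hy => by
      have h := hvert i _ (mem_image_of_mem A hy)
      rw [hmidA A, hmidA ℓ, smul_eq_mul]
      linarith)
  have hfg : IntegrableOn (fun u => (f (A u) + g (A u)) / 2) (openSimplex k) :=
    (hf'.add hg').div_const 2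
  rw [integral_sub hf' hℓ', integral_sub hg' hℓ', integral_sub hψ' hℓ'] at key
  rw [setIntegral_image_affineMap volume A hA hS, setIntegral_image_affineMap volume A hA hS,
    integral_sub hℓ' hf', integral_sub hψ' hfg, integral_div,
    integral_add hf' hg']
  have h0 : 0 ≤ |LinearMap.det A.linear| := abs_nonneg _
  nlinarith [mul_le_mul_of_nonneg_left key h0]

end SimplexInequality

/-! ### Supporting affine functions of lifted point sets -/

section Supporting

open scoped Pointwise

variable {E : Type*} [NormedAddCommGroup E] [NormedSpace ℝ E]

/-- The convex hull of the points of `P` lifted to the heights `t`. -/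
def liftedHull (P : Finset E) (t : E → ℝ) : Set (E × ℝ) :=
  convexHull ℝ ((fun p => (p, t p)) '' (P : Set E))

theorem AffineMap.apply_sum_smul {ι : Type*} (ℓ : E →ᵃ[ℝ] ℝ) (s : Finset ι) (w : ι → ℝ)
    (z : ι → E) : ℓ (∑ i ∈ s, w i • z i) = ∑ i ∈ s, w i * ℓ (z i) + (1 - ∑ i ∈ s, w i) * ℓ 0 := by
  have h : ∀ y, ℓ y = ℓ.linear y + ℓ 0 := fun y => congrFun ℓ.decomp y
  rw [h, map_sum]
  simp_rw [h (z _), map_smul, smul_eq_mul, mul_add, Finset.sum_add_distrib, ← Finset.sum_mul]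
  ring

theorem le_of_mem_liftedHull {P : Finset E} {t : E → ℝ} {ℓ : E →ᵃ[ℝ] ℝ}
    (hℓ : ∀ p ∈ P, t p ≤ ℓ p) {q : E × ℝ} (hq : q ∈ liftedHull P t) : q.2 ≤ ℓ q.1 := by
  have hconv : Convex ℝ {q : E × ℝ | q.2 ≤ ℓ q.1} := by
    intro a ha b hb s r hs hr hsr
    have h1 : ℓ (s • a.1 + r • b.1) = s • ℓ a.1 + r • ℓ b.1 := by
      rw [← Convex.combo_affine_apply hsr]
    simp only [mem_ofPred_eq, Prod.snd_add, Prod.smul_snd, Prod.fst_add, Prod.smul_fst, h1] at *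
    exact add_le_add (smul_le_smul_of_nonneg_left ha hs) (smul_le_smul_of_nonneg_left hb hr)
  refine convexHull_min ?_ hconv hq
  rintro _ ⟨p, hp, rfl⟩
  exact hℓ p hp

theorem fst_image_liftedHull (P : Finset E) (t : E → ℝ) :
    Prod.fst '' liftedHull P t = convexHull ℝ (P : Set E) := by
  have h := (LinearMap.fst ℝ E ℝ).image_convexHull ((fun p => (p, t p)) '' (P : Set E))
  rw [image_image] at h
  simpa [liftedHull] using h

/-- Complementary slackness: the weighted gaps `ℓ - t` are nonnegative and sum to zero, so only
contact points carry weight. -/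
theorem mem_convexHull_of_mem_liftedHull {P : Finset E} {t : E → ℝ} {ℓ : E →ᵃ[ℝ] ℝ}
    (hℓ : ∀ p ∈ P, t p ≤ ℓ p) {x : E} (hx : (x, ℓ x) ∈ liftedHull P t) :
    x ∈ convexHull ℝ {p : E | p ∈ P ∧ t p = ℓ p} := by
  classical
  rw [liftedHull, ← Finset.coe_image, Finset.mem_convexHull'] at hx
  obtain ⟨w, hw0, hw1, hw⟩ := hx
  have hfst : ∑ q ∈ P.image (fun p => (p, t p)), w q • q.1 = x := by
    have := congrArg Prod.fst hw
    simpa [Prod.fst_sum] using this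
  have hsnd : ∑ q ∈ P.image (fun p => (p, t p)), w q * q.2 = ℓ x := by
    have := congrArg Prod.snd hw
    simpa [Prod.snd_sum] using this
  have hℓx : ∑ q ∈ P.image (fun p => (p, t p)), w q * ℓ q.1 = ℓ x := by
    rw [← hfst, ℓ.apply_sum_smul, hw1]
    ring
  have hle : ∀ q ∈ P.image (fun p => (p, t p)), 0 ≤ w q * (ℓ q.1 - q.2) := by
    intro q hq
    obtain ⟨p, hp, rfl⟩ := Finset.mem_image.1 hq
    exact mul_nonneg (hw0 _ hq) (sub_nonneg.2 (hℓ p hp))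
  have hzero : ∑ q ∈ P.image (fun p => (p, t p)), w q * (ℓ q.1 - q.2) = 0 := by
    simp_rw [mul_sub]
    rw [Finset.sum_sub_distrib, hℓx, hsnd, sub_self]
  have hall := (Finset.sum_eq_zero_iff_of_nonneg hle).1 hzero
  rw [← hfst, ← Finset.sum_filter_of_ne (p := fun q => w q ≠ 0)
    (fun q _ h h0 => h (by rw [h0, zero_smul]))]
  refine (convex_convexHull ℝ _).sum_mem (fun q hq => hw0 q (Finset.mem_filter.1 hq).1) ?_ ?_
  · rw [← hw1]
    exact Finset.sum_filter_ne_zero _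
  · intro q hq
    obtain ⟨hqP, hq0⟩ := Finset.mem_filter.1 hq
    have h2 := (mul_eq_zero.1 (hall q hqP)).resolve_left hq0
    obtain ⟨p, hp, rfl⟩ := Finset.mem_image.1 hqP
    exact subset_convexHull ℝ _ ⟨hp, (sub_eq_zero.1 h2).symm⟩

/-- The upper hull of finitely many lifted points has a supporting affine function above every
interior point of the convex hull of these points. -/
theorem exists_supporting_affineMap (P : Finset E) (t : E → ℝ) {x : E}
    (hx : x ∈ interior (convexHull ℝ (P : Set E))) :
    ∃ ℓ : E →ᵃ[ℝ] ℝ, (∀ p ∈ P, t p ≤ ℓ p) ∧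
      x ∈ convexHull ℝ {p : E | p ∈ P ∧ t p = ℓ p} := by
  classical
  have hPne : P.Nonempty := by
    by_contra h
    rw [Finset.not_nonempty_iff_eq_empty] at h
    simp [h] at hx
  obtain ⟨p₀, hp₀, hmin⟩ := P.exists_min_image t hPne
  have hHconv : Convex ℝ (liftedHull P t) := convex_convexHull ℝ _
  have hHcomp : IsCompact (liftedHull P t) :=
    (P.finite_toSet.image _).isCompact_convexHull ℝ
  have hHmin : ∀ q ∈ liftedHull P t, t p₀ ≤ q.2 := by
    intro q hq
    refine convexHull_min (t := {q : E × ℝ | t p₀ ≤ q.2}) ?_ ?_ hq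
    · rintro _ ⟨p, hp, rfl⟩
      exact hmin p hp
    · exact convex_halfSpace_ge (LinearMap.snd ℝ E ℝ).isLinear _
  have hfib : ∀ y ∈ convexHull ℝ (P : Set E), ∃ s, (y, s) ∈ liftedHull P t := by
    intro y hy
    rw [← fst_image_liftedHull P t] at hy
    obtain ⟨⟨y', s⟩, hq, rfl⟩ := hy
    exact ⟨s, hq⟩
  obtain ⟨⟨x', r⟩, ⟨hr, hxx'⟩, hrmax⟩ :=
    (hHcomp.inter_right (isClosed_eq continuous_fst (continuous_const (y := x)))).exists_isMaxOn
      (by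
        obtain ⟨s, hs⟩ := hfib x (interior_subset hx)
        exact ⟨(x, s), hs, rfl⟩) continuous_snd.continuousOn
  obtain rfl : x' = x := hxx'
  -- Closing the lifted hull downwards gives it interior, while the highest point `(x', r)` above
  -- `x'` stays on the boundary, where Hahn–Banach applies.
  let D : Set (E × ℝ) := liftedHull P t + ({0} ×ˢ Iic 0)
  have hDconv : Convex ℝ D := hHconv.add ((convex_singleton 0).prod (convex_Iic 0))
  have hD : ∀ y s s', (y, s) ∈ liftedHull P t → s' ≤ s → (y, s') ∈ D := by
    intro y s s' h hs
    refine ⟨(y, s), h, (0, s' - s), ⟨rfl, by simpa using hs⟩, by simp⟩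
  have hDint : ∀ s < t p₀, (x', s) ∈ interior D := by
    intro s hs
    refine interior_maximal (s := D) (t := interior (convexHull ℝ (P : Set E)) ×ˢ Iio (t p₀)) ?_
      (isOpen_interior.prod isOpen_Iio) ⟨hx, hs⟩
    rintro ⟨y, s'⟩ ⟨hy, hs'⟩
    obtain ⟨s'', h⟩ := hfib y (interior_subset hy)
    exact hD y s'' s' h ((le_of_lt hs').trans (hHmin _ h))
  have hnot : (x', r) ∉ interior D := by
    intro h
    have hcont : Filter.Tendsto (fun s : ℝ => (x', s)) (nhds r) (nhds (x', r)) :=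
      Continuous.tendsto (by fun_prop) r
    have h1 := hcont.eventually (mem_interior_iff_mem_nhds.1 h)
    obtain ⟨ε, hε, hball⟩ := Metric.eventually_nhds_iff.1 h1
    have h2 : (x', r + ε / 2) ∈ D := hball (by simp [abs_of_pos hε, hε])
    obtain ⟨⟨y, s⟩, hq, ⟨z, s'⟩, ⟨hz, hs'⟩, heq⟩ := h2
    simp only [Prod.mk_add_mk, Prod.mk.injEq, mem_singleton_iff, mem_Iic] at heq hz hs'
    obtain ⟨h3, h4⟩ := heq
    rw [hz, add_zero] at h3
    subst h3
    have h5 : s ≤ r := hrmax ⟨hq, rfl⟩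
    linarith
  obtain ⟨f, hf⟩ := geometric_hahn_banach_open_point hDconv.interior isOpen_interior hnot
  have hfD : ∀ a ∈ D, f a ≤ f (x', r) := by
    intro a ha
    have h1 : a ∈ closure (interior D) := by
      rw [hDconv.closure_interior_eq_closure_of_nonempty_interior
        ⟨_, hDint (t p₀ - 1) (by linarith)⟩]
      exact subset_closure ha
    exact closure_minimal (fun a ha => (hf a ha).le)
      (isClosed_le f.continuous continuous_const) h1
  have hsplit : ∀ y s, f (y, s) = f (y, 0) + s * f (0, 1) := by
    intro y s
    have : (y, s) = (y, (0 : ℝ)) + s • ((0 : E), (1 : ℝ)) := by simp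
    rw [this, map_add, map_smul, smul_eq_mul]
  -- The supporting hyperplane is not vertical: an interior point of `D` lies directly below `(x',
  -- r)`.
  have hc : 0 < f (0, 1) := by
    have h1 := hf _ (hDint (t p₀ - 1) (by linarith))
    rw [hsplit x' r, hsplit x' (t p₀ - 1)] at h1
    have h2 := hHmin _ hr
    simp only at h2
    by_contra h
    nlinarith
  -- The height `ℓ y` is the solution `s` of `f (y, s) = f (x', r)`.
  let ℓ : E →ᵃ[ℝ] ℝ := AffineMap.const ℝ E (r + f (x', 0) / f (0, 1)) -
    ((f (0, 1))⁻¹ • (f.toLinearMap ∘ₗ LinearMap.inl ℝ E ℝ)).toAffineMap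
  have hℓ : ∀ y, ℓ y = r + f (x', 0) / f (0, 1) - f (y, 0) / f (0, 1) := by
    intro y
    simp [ℓ, div_eq_inv_mul]
  have hℓP : ∀ p ∈ P, t p ≤ ℓ p := by
    intro p hp
    have h1 := hfD (p, t p) (hD p (t p) _ (subset_convexHull ℝ _ ⟨p, hp, rfl⟩) le_rfl)
    rw [hsplit, hsplit x' r] at h1
    rw [hℓ, ← sub_nonneg]
    have : r + f (x', 0) / f (0, 1) - f (p, 0) / f (0, 1) - t p =
        (f (x', 0) + r * f (0, 1) - (f (p, 0) + t p * f (0, 1))) / f (0, 1) := by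
      field_simp
      ring
    rw [this]
    exact div_nonneg (by linarith) hc.le
  refine ⟨ℓ, hℓP, mem_convexHull_of_mem_liftedHull hℓP ?_⟩
  have : ℓ x' = r := by rw [hℓ]; ring
  rwa [this]

end Supporting

/-! ### Generic heights and the induced triangulation -/

section Triangulation

variable {E : Type*} [NormedAddCommGroup E] [NormedSpace ℝ E]

/-- The heights `t` are generic on `P`: points of `P` whose lifts lie on a common non-vertical
hyperplane are affinely independent. -/
def IsGenericHeight (P : Finset E) (t : E → ℝ) : Prop :=
  ∀ Q ⊆ P, (∃ ℓ : E →ᵃ[ℝ] ℝ, ∀ p ∈ Q, t p = ℓ p) → AffineIndependent ℝ (fun p : Q => (p : E))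

/-- The vertex sets of the full-dimensional facets of the upper hull of the lifted points. -/
def upperFacets (P : Finset E) (t : E → ℝ) : Set (Finset E) :=
  {Q | Q ⊆ P ∧ affineSpan ℝ (Q : Set E) = ⊤ ∧
    ∃ ℓ : E →ᵃ[ℝ] ℝ, (∀ p ∈ P, t p ≤ ℓ p) ∧ ∀ p, p ∈ Q ↔ p ∈ P ∧ t p = ℓ p}

theorem finite_upperFacets (P : Finset E) (t : E → ℝ) : (upperFacets P t).Finite :=
  P.powerset.finite_toSet.subset fun _ hQ => Finset.mem_coe.2 (Finset.mem_powerset.2 hQ.1)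

theorem IsGenericHeight.affineIndependent {P : Finset E} {t : E → ℝ} (h : IsGenericHeight P t)
    {Q : Finset E} (hQ : Q ∈ upperFacets P t) : AffineIndependent ℝ (fun p : Q => (p : E)) := by
  obtain ⟨hQP, _, ℓ, _, hℓ⟩ := hQ
  exact h Q hQP ⟨ℓ, fun p hp => ((hℓ p).1 hp).2⟩

/-- An affine dependence on `Q` becomes a nontrivial linear relation on heights that lie on a
hyperplane. The finitely many kernels are null sets, so an open box of heights is not covered by
them. Heights are only lowered, which keeps the lifted points under the graph of `f`. -/
theorem exists_isGenericHeight (P : Finset E) (t : E → ℝ) {ε : ℝ} (hε : 0 < ε) :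
    ∃ t' : E → ℝ, (∀ p ∈ P, t p - ε ≤ t' p ∧ t' p ≤ t p) ∧ IsGenericHeight P t' := by
  classical
  have hdep : ∀ Q : Finset E, ∃ w : E → ℝ, ¬ AffineIndependent ℝ (fun p : Q => (p : E)) →
      ∑ p ∈ Q, w p • p = 0 ∧ ∑ p ∈ Q, w p = 0 ∧ ∃ p ∈ Q, w p ≠ 0 := by
    intro Q
    by_cases h : AffineIndependent ℝ (fun p : Q => (p : E))
    · exact ⟨0, fun h' => absurd h h'⟩
    · obtain ⟨w, h1⟩ := exists_nontrivial_relation_sum_zero_of_not_affine_ind h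
      exact ⟨w, fun _ => h1⟩
  choose w hw using hdep
  let L : Finset E → (P → ℝ) →ₗ[ℝ] ℝ := fun Q =>
    ∑ p : P, (if (p : E) ∈ Q then w Q p else 0) • LinearMap.proj p
  have hL : ∀ Q (s : P → ℝ), L Q s = ∑ p : P, (if (p : E) ∈ Q then w Q p else 0) * s p := by
    intro Q s
    simp only [L, LinearMap.sum_apply, LinearMap.smul_apply, LinearMap.proj_apply, smul_eq_mul]
  let bad : Set (P → ℝ) := ⋃ Q ∈ P.powerset.filter
    (fun Q : Finset E => ¬ AffineIndependent ℝ (fun p : Q => (p : E))), (LinearMap.ker (L Q) : Set (P → ℝ))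
  have hbad : volume bad = 0 := by
    refine (measure_biUnion_null_iff (Finset.countable_toSet _)).2 fun Q hQ => ?_
    obtain ⟨hQP, hQ⟩ := Finset.mem_filter.1 (Finset.mem_coe.1 hQ)
    refine Measure.addHaar_submodule _ _ fun htop => ?_
    obtain ⟨-, -, p, hp, hwp⟩ := hw Q hQ
    have hpP := Finset.mem_powerset.1 hQP hp
    have h1 : L Q (Pi.single ⟨p, hpP⟩ 1) = 0 := by
      rw [← LinearMap.mem_ker, htop]; trivial
    rw [hL, Finset.sum_eq_single ⟨p, hpP⟩] at h1
    · simp [hp, hwp] at h1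
    · intro q _ hq
      simp [hq]
    · simp
  let box : Set (P → ℝ) := Set.pi univ fun p => Ioo (t p - ε) (t p)
  have hbox : 0 < volume box := by
    refine (isOpen_set_pi finite_univ fun p _ => isOpen_Ioo).measure_pos volume
      ⟨fun p => t p - ε / 2, fun p _ => ⟨?_, ?_⟩⟩ <;> dsimp only <;> linarith
  obtain ⟨s, hs, hsbad⟩ : (box \ bad).Nonempty := by
    rw [nonempty_iff_ne_empty]
    intro h
    rw [sdiff_eq_empty] at h
    exact hbox.ne' (measure_mono_null h hbad)
  refine ⟨fun p => if h : p ∈ P then s ⟨p, h⟩ else 0, fun p hp => ?_, ?_⟩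
  · have := hs ⟨p, hp⟩ trivial
    simp only [hp, dite_true]
    exact ⟨this.1.le, this.2.le⟩
  · rintro Q hQP ⟨ℓ, hℓ⟩
    by_contra hQ
    obtain ⟨h1, h2, -⟩ := hw Q hQ
    refine hsbad (mem_iUnion₂.2 ⟨Q, Finset.mem_filter.2 ⟨Finset.mem_powerset.2 hQP, hQ⟩, ?_⟩)
    rw [SetLike.mem_coe, LinearMap.mem_ker, hL]
    have h3 : ∑ p : P, (if (p : E) ∈ Q then w Q p else 0) * s p =
        ∑ p : P, if (p : E) ∈ Q then w Q p * ℓ p else 0 := by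
      refine Finset.sum_congr rfl fun p _ => ?_
      split_ifs with hp
      · rw [← hℓ p hp]; simp
      · simp
    rw [h3, Finset.sum_coe_sort P (fun p => if p ∈ Q then w Q p * ℓ p else 0),
      Finset.sum_ite_mem, Finset.inter_eq_right.2 hQP]
    have h4 := ℓ.apply_sum_smul Q (w Q) id
    simp only [id, h1, h2] at h4
    linarith

theorem exists_pos_weights_of_mem_interior_convexHull {Q : Finset E}
    (hind : AffineIndependent ℝ (fun p : Q => (p : E))) (hspan : affineSpan ℝ (Q : Set E) = ⊤)
    {x : E} (hx : x ∈ interior (convexHull ℝ (Q : Set E))) :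
    ∃ w : Q → ℝ, (∀ p, 0 < w p) ∧ ∑ p, w p = 1 ∧ ∑ p, w p • (p : E) = x := by
  let b : AffineBasis Q ℝ E := ⟨fun p => (p : E), hind, by simpa using hspan⟩
  have hb : range b = (Q : Set E) := by
    change range (fun p : Q => (p : E)) = _
    simp
  rw [← hb, b.interior_convexHull] at hx
  exact ⟨fun p => b.coord p x, hx, b.sum_coord_apply_eq_one x, b.linear_combination_coord_eq_self x⟩

/-- Interpolating `t ≤ ℓ` on `Q'` gives `ℓ' x ≤ ℓ x`. On `Q`, where `t = ℓ`, the gaps `ℓ' - t ≥ 0`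
then have nonpositive mean with strictly positive weights, so they vanish and every point of `Q` is
a contact point of `ℓ'`. -/
theorem subset_of_mem_interior_of_mem_interior {P : Finset E} {t : E → ℝ}
    (h : IsGenericHeight P t) {Q Q' : Finset E} (hQ : Q ∈ upperFacets P t)
    (hQ' : Q' ∈ upperFacets P t) {x : E} (hx : x ∈ interior (convexHull ℝ (Q : Set E)))
    (hx' : x ∈ interior (convexHull ℝ (Q' : Set E))) : Q ⊆ Q' := by
  obtain ⟨w, hw, hw1, hwx⟩ :=
    exists_pos_weights_of_mem_interior_convexHull (h.affineIndependent hQ) hQ.2.1 hx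
  obtain ⟨w', hw', hw1', hwx'⟩ :=
    exists_pos_weights_of_mem_interior_convexHull (h.affineIndependent hQ') hQ'.2.1 hx'
  obtain ⟨hQP, -, ℓ, hℓ, hQℓ⟩ := hQ
  obtain ⟨hQP', -, ℓ', hℓ', hQℓ'⟩ := hQ'
  have e1 : ∀ m : E →ᵃ[ℝ] ℝ, m x = ∑ p, w p * m p := by
    intro m
    rw [← hwx, m.apply_sum_smul, hw1]; ring
  have e2 : ∀ m : E →ᵃ[ℝ] ℝ, m x = ∑ p, w' p * m p := by
    intro m
    rw [← hwx', m.apply_sum_smul, hw1']; ring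
  have hle : ℓ' x ≤ ℓ x := by
    rw [e2 ℓ, e2 ℓ']
    refine Finset.sum_le_sum fun p _ => mul_le_mul_of_nonneg_left ?_ (hw' p).le
    rw [← ((hQℓ' p).1 p.2).2]
    exact hℓ p (hQP' p.2)
  have hnn : ∀ p ∈ (Finset.univ : Finset Q), 0 ≤ w p * (ℓ' p - t p) := fun p _ =>
    mul_nonneg (hw p).le (sub_nonneg.2 (hℓ' p (hQP p.2)))
  have hsum : ∑ p, w p * (ℓ' p - t p) = 0 := by
    refine le_antisymm ?_ (Finset.sum_nonneg hnn)
    have h1 : ∑ p, w p * (ℓ' p - t p) = ∑ p, w p * ℓ' p - ∑ p, w p * ℓ p := by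
      rw [← Finset.sum_sub_distrib]
      refine Finset.sum_congr rfl fun p _ => ?_
      rw [((hQℓ p).1 p.2).2]; ring
    rw [h1, ← e1, ← e1]
    linarith
  intro p hp
  have h2 := (Finset.sum_eq_zero_iff_of_nonneg hnn).1 hsum ⟨p, hp⟩ (Finset.mem_univ _)
  have h3 := (mul_eq_zero.1 h2).resolve_left (hw _).ne'
  exact (hQℓ' p).2 ⟨hQP hp, (sub_eq_zero.1 h3).symm⟩

theorem pairwiseDisjoint_upperFacets {P : Finset E} {t : E → ℝ} (h : IsGenericHeight P t) :
    (upperFacets P t).PairwiseDisjoint fun Q => interior (convexHull ℝ (Q : Set E)) := by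
  intro Q hQ Q' hQ' hne
  refine Set.disjoint_left.2 fun x hx hx' => hne ?_
  exact (subset_of_mem_interior_of_mem_interior h hQ hQ' hx hx').antisymm
    (subset_of_mem_interior_of_mem_interior h hQ' hQ hx' hx)

variable [FiniteDimensional ℝ E] [MeasurableSpace E] [BorelSpace E] (μ : Measure E)
  [μ.IsAddHaarMeasure]

/-- Away from the null frontiers of the hulls of all subsets of `P`, lying in the hull of the
contact set means lying in its interior, which forces the contact set to span. -/
theorem ae_mem_interior_upperFacets (P : Finset E) (t : E → ℝ) :
    ∀ᵐ x ∂μ, x ∈ convexHull ℝ (P : Set E) →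
      ∃ Q ∈ upperFacets P t, x ∈ interior (convexHull ℝ (Q : Set E)) := by
  classical
  have hfr : ∀ᵐ x ∂μ, ∀ Q ∈ P.powerset, x ∉ frontier (convexHull ℝ (Q : Set E)) := by
    rw [Finset.eventually_all]
    exact fun Q _ => measure_eq_zero_iff_ae_notMem.1 ((convex_convexHull ℝ _).addHaar_frontier μ)
  filter_upwards [hfr] with x hx hxP
  have hint : ∀ Q ∈ P.powerset, x ∈ convexHull ℝ (Q : Set E) →
      x ∈ interior (convexHull ℝ (Q : Set E)) := fun Q hQ hxQ => by
    by_contra h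
    exact hx Q hQ ⟨subset_closure hxQ, h⟩
  obtain ⟨ℓ, hℓ, hxℓ⟩ := exists_supporting_affineMap P t
    (hint P (Finset.mem_powerset_self P) hxP)
  have hcoe : {p : E | p ∈ P ∧ t p = ℓ p} = (P.filter fun p => t p = ℓ p : Finset E) := by
    ext p; simp
  rw [hcoe] at hxℓ
  have hxi := hint _ (Finset.mem_powerset.2 (Finset.filter_subset _ _)) hxℓ
  exact ⟨_, ⟨Finset.filter_subset _ _, interior_convexHull_nonempty_iff_affineSpan_eq_top.1
    ⟨x, hxi⟩, ℓ, hℓ, fun p => Finset.mem_filter⟩, hxi⟩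

end Triangulation

/-! ### Simplices as affine images of the standard simplex -/

section SimplexParametrization

variable {k : ℕ}

/-- A nondegenerate simplex is an affine image of the standard simplex. -/
theorem exists_affineMap_image_openSimplex {Q : Finset (EuclideanSpace ℝ (Fin k))}
    (hind : AffineIndependent ℝ (fun p : Q => (p : EuclideanSpace ℝ (Fin k))))
    (hspan : affineSpan ℝ (Q : Set (EuclideanSpace ℝ (Fin k))) = ⊤) :
    ∃ A : EuclideanSpace ℝ (Fin k) →ᵃ[ℝ] EuclideanSpace ℝ (Fin k),
      LinearMap.det A.linear ≠ 0 ∧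
      A '' openSimplex k = interior (convexHull ℝ (Q : Set (EuclideanSpace ℝ (Fin k)))) ∧
      ∀ i, A (WithLp.toLp 2 (stdVertex k i)) ∈ Q := by
  have hcard : Fintype.card Q = k + 1 := by
    have h1 : affineSpan ℝ (range fun p : Q => (p : EuclideanSpace ℝ (Fin k))) = ⊤ := by
      simpa using hspan
    rw [hind.affineSpan_eq_top_iff_card_eq_finrank_add_one] at h1
    simpa using h1
  let e : Q ≃ Fin (k + 1) := Fintype.equivFinOfCardEq hcard
  let b₀ : AffineBasis Q ℝ (EuclideanSpace ℝ (Fin k)) :=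
    ⟨fun p => (p : EuclideanSpace ℝ (Fin k)), hind, by simpa using hspan⟩
  let b := b₀.reindex e
  have hbQ : ∀ i, b i ∈ Q := fun i => by
    simp only [b, AffineBasis.reindex_apply]
    exact (e.symm i).2
  have hb : range b = (Q : Set (EuclideanSpace ℝ (Fin k))) := by
    ext p
    constructor
    · rintro ⟨i, rfl⟩
      exact hbQ i
    · intro hp
      exact ⟨e ⟨p, hp⟩, by simp only [b, AffineBasis.reindex_apply, e.symm_apply_apply]; rfl⟩
  let A := simplexMap fun i => WithLp.ofLp (b i)
  have hA : ∀ u, A u = ∑ i, stdCoord i u • b i := by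
    intro u
    ext l
    simp only [A, simplexMap_apply, Fin.sum_univ_succ, stdCoord, Fin.cases_zero, Fin.cases_succ,
      PiLp.add_apply, PiLp.smul_apply, smul_eq_mul, WithLp.ofLp_sum, Finset.sum_apply,
      WithLp.ofLp_smul, Pi.smul_apply, sub_mul, Finset.sum_sub_distrib, Finset.sum_mul]
    simp only [mul_comm]
    ring
  let B : EuclideanSpace ℝ (Fin k) → EuclideanSpace ℝ (Fin k) :=
    fun x => WithLp.toLp 2 fun j => b.coord j.succ x
  have hcoordB : ∀ x i, stdCoord i (B x) = b.coord i x := by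
    intro x i
    induction i using Fin.cases with
    | zero =>
      have := b.sum_coord_apply_eq_one x
      rw [Fin.sum_univ_succ] at this
      simp only [stdCoord, Fin.cases_zero, B]
      linarith
    | succ i => simp [stdCoord, B]
  have hAB : ∀ x, A (B x) = x := by
    intro x
    simp_rw [hA, hcoordB]
    exact b.linear_combination_coord_eq_self x
  have hsurj : Function.Surjective A.linear :=
    A.linear_surjective_iff.2 fun x => ⟨B x, hAB x⟩
  have hinj : Function.Injective A.linear := LinearMap.injective_iff_surjective.2 hsurj
  have hdet : LinearMap.det A.linear ≠ 0 :=
    (LinearEquiv.isUnit_det' (LinearEquiv.ofBijective A.linear ⟨hinj, hsurj⟩)).ne_zero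
  have hBA : ∀ u, B (A u) = u := fun u =>
    (A.linear_injective_iff.1 hinj) (hAB (A u))
  refine ⟨A, hdet, ?_, fun i => ?_⟩
  · rw [← hb, b.interior_convexHull]
    ext x
    constructor
    · rintro ⟨u, hu, rfl⟩ i
      rw [← hcoordB, hBA]
      exact (mem_openSimplex_iff u).1 hu i
    · intro hx
      refine ⟨B x, (mem_openSimplex_iff _).2 fun i => ?_, hAB x⟩
      rw [hcoordB]
      exact hx i
  · rw [hA]
    simp only [stdCoord_stdVertex, ite_smul, one_smul, zero_smul, Finset.sum_ite_eq',
      Finset.mem_univ, if_true]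
    exact hbQ i

end SimplexParametrization

/-! ### Summation over the facets -/

section PolyhedralBound

variable {k : ℕ}

/-- The sup-convolution inequality with `co f - f` replaced by a function lying below `ℓ - f` for
every affine function `ℓ` above finitely many points of the hypograph of `f`. -/
theorem polyhedral_supConv_inequality (hk : HasMidpointDissection k)
    {C : Set (EuclideanSpace ℝ (Fin k))} (hC : IsCompact C) (hCconv : Convex ℝ C)
    {f g ψ θ : EuclideanSpace ℝ (Fin k) → ℝ} (hf : IntegrableOn f C) (hg : IntegrableOn g C)
    (hψ : IntegrableOn ψ C) (hθ : IntegrableOn θ C)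
    (hmid : ∀ x ∈ C, ∀ y ∈ C, (f x + g y) / 2 ≤ ψ ((1 / 2 : ℝ) • (x + y)))
    {P : Finset (EuclideanSpace ℝ (Fin k))} (hP : (P : Set (EuclideanSpace ℝ (Fin k))) ⊆ C)
    {t : EuclideanSpace ℝ (Fin k) → ℝ} (htf : ∀ p ∈ P, t p ≤ f p) (ht : IsGenericHeight P t)
    (hin : ∀ x ∈ convexHull ℝ (P : Set (EuclideanSpace ℝ (Fin k))),
      ∀ ℓ : EuclideanSpace ℝ (Fin k) →ᵃ[ℝ] ℝ, (∀ p ∈ P, t p ≤ ℓ p) → θ x ≤ ℓ x - f x)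
    (hout : ∀ x ∈ C, x ∉ convexHull ℝ (P : Set (EuclideanSpace ℝ (Fin k))) → θ x ≤ 0) :
    ((k : ℝ) + 1) / 2 ^ (k + 1) * ∫ x in C, θ x ≤ ∫ x in C, (ψ x - (f x + g x) / 2) := by
  classical
  let O : Finset (EuclideanSpace ℝ (Fin k)) → Set (EuclideanSpace ℝ (Fin k)) :=
    fun Q => interior (convexHull ℝ (Q : Set (EuclideanSpace ℝ (Fin k))))
  let 𝒬 := (finite_upperFacets P t).toFinset
  have h𝒬 : ∀ Q ∈ 𝒬, Q ∈ upperFacets P t := fun Q hQ =>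
    (finite_upperFacets P t).mem_toFinset.1 hQ
  have hPC : convexHull ℝ (P : Set (EuclideanSpace ℝ (Fin k))) ⊆ C := convexHull_min hP hCconv
  have hOP : ∀ Q ∈ 𝒬, O Q ⊆ convexHull ℝ (P : Set (EuclideanSpace ℝ (Fin k))) := fun Q hQ =>
    interior_subset.trans (convexHull_mono (Finset.coe_subset.2 (h𝒬 Q hQ).1))
  have hOC : ∀ Q ∈ 𝒬, O Q ⊆ C := fun Q hQ => (hOP Q hQ).trans hPC
  have hOmeas : ∀ Q, MeasurableSet (O Q) := fun Q => isOpen_interior.measurableSet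
  have hdisj : Set.Pairwise (𝒬 : Set (Finset (EuclideanSpace ℝ (Fin k))))
      (Function.onFun Disjoint O) := fun Q hQ Q' hQ' hne =>
    pairwiseDisjoint_upperFacets ht (h𝒬 Q hQ) (h𝒬 Q' hQ') hne
  let U := ⋃ Q ∈ 𝒬, O Q
  have hUmeas : MeasurableSet U := Finset.measurableSet_biUnion _ fun Q _ => hOmeas Q
  have hUC : U ⊆ C := iUnion₂_subset hOC
  have hcover : ∀ᵐ x, x ∈ convexHull ℝ (P : Set (EuclideanSpace ℝ (Fin k))) → x ∈ U := by
    filter_upwards [ae_mem_interior_upperFacets volume P t] with x hx hxP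
    obtain ⟨Q, hQ, hxQ⟩ := hx hxP
    exact mem_iUnion₂.2 ⟨Q, (finite_upperFacets P t).mem_toFinset.2 hQ, hxQ⟩
  have hc : (0 : ℝ) ≤ ((k : ℝ) + 1) / 2 ^ (k + 1) := by positivity
  have hφ : IntegrableOn (fun x => ψ x - (f x + g x) / 2) C := hψ.sub ((hf.add hg).div_const 2)
  -- Taking `x = y` in `hmid`; nonnegativity allows passing from the tiled region `U` to all of `C`
  -- at the end.
  have hφ0 : ∀ x ∈ C, 0 ≤ ψ x - (f x + g x) / 2 := fun x hx => by
    have h := hmid x hx x hx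
    rw [← two_smul ℝ x, smul_smul] at h
    norm_num at h
    linarith
  have hfacet : ∀ Q ∈ 𝒬, ((k : ℝ) + 1) / 2 ^ (k + 1) * ∫ x in O Q, θ x ≤
      ∫ x in O Q, (ψ x - (f x + g x) / 2) := by
    intro Q hQ
    obtain ⟨A, hA, hAO, hAQ⟩ :=
      exists_affineMap_image_openSimplex (ht.affineIndependent (h𝒬 Q hQ)) (h𝒬 Q hQ).2.1
    obtain ⟨hQP, -, ℓ, hℓ, hQℓ⟩ := h𝒬 Q hQ
    have hℓint : IntegrableOn ℓ (O Q) :=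
      (ℓ.continuous_of_finiteDimensional.continuousOn.integrableOn_compact hC).mono_set (hOC Q hQ)
    have hf' := hf.mono_set (hOC Q hQ)
    have key := simplex_supConv_inequality hk A hA ℓ (f := f) (g := g) (ψ := ψ)
    rw [hAO] at key
    refine le_trans (mul_le_mul_of_nonneg_left ?_ hc) (key hℓint hf' (hg.mono_set (hOC Q hQ))
      (hψ.mono_set (hOC Q hQ)) (fun x hx y hy => hmid x (hOC Q hQ hx) y (hOC Q hQ hy))
      fun i y hy => ?_)
    · exact setIntegral_mono_on (hθ.mono_set (hOC Q hQ)) (hℓint.sub hf') (hOmeas Q)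
        fun x hx => hin x (hOP Q hQ hx) ℓ hℓ
    -- A facet vertex `v` satisfies `ℓ v = t v ≤ f v`, so `hmid` at `v` itself supplies the vertex
    -- hypothesis.
    · have hv := hAQ i
      have h1 := hmid _ (hP (hQP hv)) y (hOC Q hQ hy)
      have h2 := htf _ (hQP hv)
      rw [((hQℓ _).1 hv).2] at h2
      linarith
  have hθU : ∫ x in C, θ x ≤ ∫ x in U, θ x := by
    have h1 := integral_inter_add_sdiff (s := C) hUmeas hθ
    rw [inter_eq_self_of_subset_right hUC] at h1
    have h2 : ∫ x in C \ U, θ x ≤ 0 := by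
      refine integral_nonpos_of_ae ?_
      filter_upwards [ae_restrict_of_ae hcover,
        ae_restrict_mem (hC.measurableSet.diff hUmeas)] with x hx hxC
      exact hout x hxC.1 fun h => hxC.2 (hx h)
    linarith
  calc ((k : ℝ) + 1) / 2 ^ (k + 1) * ∫ x in C, θ x
      ≤ ((k : ℝ) + 1) / 2 ^ (k + 1) * ∫ x in U, θ x := mul_le_mul_of_nonneg_left hθU hc
    _ = ∑ Q ∈ 𝒬, ((k : ℝ) + 1) / 2 ^ (k + 1) * ∫ x in O Q, θ x := by
        rw [integral_biUnion_finset 𝒬 (fun Q _ => hOmeas Q) hdisj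
          (fun Q hQ => hθ.mono_set (hOC Q hQ)), Finset.mul_sum]
    _ ≤ ∑ Q ∈ 𝒬, ∫ x in O Q, (ψ x - (f x + g x) / 2) := Finset.sum_le_sum hfacet
    _ = ∫ x in U, (ψ x - (f x + g x) / 2) := by
        rw [integral_biUnion_finset 𝒬 (fun Q _ => hOmeas Q) hdisj
          (fun Q hQ => hφ.mono_set (hOC Q hQ))]
    _ ≤ ∫ x in C, (ψ x - (f x + g x) / 2) :=
        setIntegral_mono_set hφ ((ae_restrict_mem hC.measurableSet).mono hφ0)
          (Filter.Eventually.of_forall hUC)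

end PolyhedralBound

/-! ### Approximation and integrability of the upper hull -/

section UpperHull

theorem integrableOn_of_aemeasurable_of_abs_le {E : Type*} [NormedAddCommGroup E]
    [MeasurableSpace E] [BorelSpace E] {C : Set E} {f : E → ℝ} {M : ℝ} {μ : Measure E}
    [IsFiniteMeasureOnCompacts μ] (hC : IsCompact C) (hf : ∀ y ∈ C, |f y| ≤ M)
    (hmeas : AEMeasurable f (μ.restrict C)) : IntegrableOn f C μ := by
  have hfin : IsFiniteMeasure (μ.restrict C) := ⟨by simpa using hC.measure_lt_top⟩
  refine Integrable.of_bound hmeas.aestronglyMeasurable M ?_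
  filter_upwards [ae_restrict_mem hC.measurableSet] with x hx
  exact hf x hx

variable {E : Type*} [NormedAddCommGroup E] [NormedSpace ℝ E] {C : Set E} {f : E → ℝ} {M : ℝ}

theorem upperHull_le {h : E → ℝ} (hh : ConcaveOn ℝ C h) (hfh : ∀ y ∈ C, f y ≤ h y) {x : E}
    (hx : x ∈ C) : upperHull C f x ≤ h x :=
  csInf_le ⟨f x, by rintro _ ⟨h', -, h2, rfl⟩; exact h2 x hx⟩ ⟨h, hh, hfh, rfl⟩

theorem le_upperHull_of_forall (hC : Convex ℝ C) (hf : ∀ y ∈ C, f y ≤ M) {x : E} {r : ℝ}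
    (hr : ∀ h : E → ℝ, ConcaveOn ℝ C h → (∀ y ∈ C, f y ≤ h y) → r ≤ h x) :
    r ≤ upperHull C f x := by
  refine le_csInf ⟨M, fun _ => M, concaveOn_const M hC, hf, rfl⟩ ?_
  rintro _ ⟨h, h1, h2, rfl⟩
  exact hr h h1 h2

theorem le_upperHull (hC : Convex ℝ C) (hf : ∀ y ∈ C, f y ≤ M) {x : E} (hx : x ∈ C) :
    f x ≤ upperHull C f x :=
  le_upperHull_of_forall hC hf fun _ _ h => h x hx

theorem concaveOn_upperHull (hC : Convex ℝ C) (hf : ∀ y ∈ C, f y ≤ M) :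
    ConcaveOn ℝ C (upperHull C f) := by
  refine ⟨hC, fun x hx y hy a b ha hb hab => le_upperHull_of_forall hC hf fun h h1 h2 => ?_⟩
  exact (add_le_add (smul_le_smul_of_nonneg_left (upperHull_le h1 h2 hx) ha)
    (smul_le_smul_of_nonneg_left (upperHull_le h1 h2 hy) hb)).trans (h1.2 hx hy ha hb hab)

theorem liftedHull_mono {P Q : Finset E} (h : P ⊆ Q) (t : E → ℝ) :
    liftedHull P t ⊆ liftedHull Q t :=
  convexHull_mono (image_mono (Finset.coe_subset.2 h))

/-- The upper hull is approximated from below by finite convex combinations of values of `f`. -/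
theorem exists_liftedHull_ge_upperHull (hC : Convex ℝ C) (hf : ∀ y ∈ C, |f y| ≤ M) {x : E}
    (hx : x ∈ C) {ε : ℝ} (hε : 0 < ε) :
    ∃ P : Finset E, (P : Set E) ⊆ C ∧ ∃ s, (x, s) ∈ liftedHull P f ∧ upperHull C f x - ε ≤ s := by
  classical
  let H : Set (E × ℝ) := convexHull ℝ ((fun p => (p, f p)) '' C)
  have hHM : ∀ q ∈ H, q.2 ≤ M := by
    intro q hq
    refine convexHull_min (t := {q : E × ℝ | q.2 ≤ M}) ?_ ?_ hq
    · rintro _ ⟨p, hp, rfl⟩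
      exact (abs_le.1 (hf p hp)).2
    · exact convex_halfSpace_le (LinearMap.snd ℝ E ℝ).isLinear _
  have hmem : ∀ y ∈ C, (y, f y) ∈ H := fun y hy => subset_convexHull ℝ _ ⟨y, hy, rfl⟩
  have hbdd : ∀ y, BddAbove {s | (y, s) ∈ H} := fun y => ⟨M, fun s hs => hHM _ hs⟩
  -- The upper envelope of the convex hull of the graph is a concave majorant of `f`, hence at least
  -- the upper hull.
  let G : E → ℝ := fun y => sSup {s | (y, s) ∈ H}
  have hG : ConcaveOn ℝ C G := by
    refine ⟨hC, fun y hy z hz a b ha hb hab => ?_⟩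
    refine le_of_forall_pos_le_add fun δ hδ => ?_
    obtain ⟨s, hs, hs'⟩ := exists_lt_of_lt_csSup ⟨f y, hmem y hy⟩ (sub_lt_self (G y) hδ)
    obtain ⟨r, hr, hr'⟩ := exists_lt_of_lt_csSup ⟨f z, hmem z hz⟩ (sub_lt_self (G z) hδ)
    have h1 : a • s + b • r ≤ G (a • y + b • z) :=
      le_csSup (hbdd _) ((convex_convexHull ℝ _) hs hr ha hb hab)
    have h2 := add_le_add (mul_le_mul_of_nonneg_left hs'.le ha)
      (mul_le_mul_of_nonneg_left hr'.le hb)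
    simp only [smul_eq_mul] at h1 ⊢
    have h3 : a * (G y - δ) + b * (G z - δ) = a * G y + b * G z - δ := by
      rw [← eq_sub_iff_add_eq] at hab
      rw [hab]; ring
    linarith
  have hfG : ∀ y ∈ C, f y ≤ G y := fun y hy => le_csSup (hbdd y) (hmem y hy)
  obtain ⟨s, hs, hs'⟩ := exists_lt_of_lt_csSup ⟨f x, hmem x hx⟩ (sub_lt_self (G x) hε)
  have hs2 : (x, s) ∈ convexHull ℝ ((fun p => (p, f p)) '' C) := hs
  rw [convexHull_eq_union_convexHull_finite_subsets] at hs2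
  obtain ⟨T, hT, hxT⟩ := mem_iUnion₂.1 hs2
  refine ⟨T.image Prod.fst, ?_, s, ?_, ?_⟩
  · intro p hp
    obtain ⟨q, hq, rfl⟩ := Finset.mem_image.1 (Finset.mem_coe.1 hp)
    obtain ⟨p', hp', rfl⟩ := hT hq
    exact hp'
  · refine convexHull_mono (fun q hq => ?_) hxT
    obtain ⟨p, hp, rfl⟩ := hT hq
    exact ⟨p, by simpa using ⟨_, hq⟩, rfl⟩
  · have := upperHull_le hG hfG hx
    linarith

variable [FiniteDimensional ℝ E]

/-- The upper hull is concave, hence continuous at interior points. Surround `x` by a small simplex,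
approximate at its vertices, and interpolate. Two oscillations and one approximation error cost `ε /
3` each. -/
theorem exists_liftedHull_ge_upperHull_nhds (hC : Convex ℝ C) (hf : ∀ y ∈ C, |f y| ≤ M) {x : E}
    (hx : x ∈ interior C) {ε : ℝ} (hε : 0 < ε) :
    ∃ U ∈ nhds x, ∃ P : Finset E, (P : Set E) ⊆ C ∧
      ∀ y ∈ U, ∃ s, (y, s) ∈ liftedHull P f ∧ upperHull C f y - ε ≤ s := by
  classical
  have hf' : ∀ y ∈ C, f y ≤ M := fun y hy => (abs_le.1 (hf y hy)).2
  have hcont : ContinuousAt (upperHull C f) x :=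
    (concaveOn_upperHull hC hf').continuousOn_interior.continuousAt (isOpen_interior.mem_nhds hx)
  have hV : {y | y ∈ interior C ∧ |upperHull C f y - upperHull C f x| < ε / 3} ∈ nhds x := by
    filter_upwards [isOpen_interior.mem_nhds hx,
      Metric.tendsto_nhds.1 hcont (ε / 3) (by positivity)] with y h1 h2
    exact ⟨h1, h2⟩
  obtain ⟨b, hxb, hbV⟩ := exists_mem_interior_convexHull_affineBasis hV
  have hbi : ∀ i, b i ∈ convexHull ℝ (range b) := fun i =>
    subset_convexHull ℝ _ (mem_range_self i)
  have hex := fun i => exists_liftedHull_ge_upperHull hC hf (interior_subset (hbV (hbi i)).1)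
    (by positivity : 0 < ε / 3)
  choose P hPC s hs hsle using hex
  refine ⟨convexHull ℝ (range b), mem_interior_iff_mem_nhds.1 hxb, Finset.univ.biUnion P, ?_,
    fun y hy => ?_⟩
  · intro p hp
    obtain ⟨i, -, hi⟩ := Finset.mem_biUnion.1 (Finset.mem_coe.1 hp)
    exact hPC i hi
  · have hyV := hbV hy
    rw [b.convexHull_eq_nonneg_coord] at hy
    refine ⟨∑ i, b.coord i y * s i, ?_, ?_⟩
    · have h1 : ∑ i, b.coord i y • ((b i, s i) : E × ℝ) ∈
          liftedHull (Finset.univ.biUnion P) f :=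
        (convex_convexHull ℝ _).sum_mem (fun i _ => hy i) (b.sum_coord_apply_eq_one y)
          fun i _ => liftedHull_mono (Finset.subset_biUnion_of_mem P (Finset.mem_univ i)) f (hs i)
      convert h1 using 1
      ext
      · simp [Prod.fst_sum, b.linear_combination_coord_eq_self]
      · simp [Prod.snd_sum]
    · have h2 : ∀ i, upperHull C f x - 2 * (ε / 3) ≤ s i := fun i => by
        have := (abs_lt.1 (hbV (hbi i)).2).1
        linarith [hsle i]
      have h3 : ∑ i, b.coord i y * (upperHull C f x - 2 * (ε / 3)) ≤ ∑ i, b.coord i y * s i :=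
        Finset.sum_le_sum fun i _ => mul_le_mul_of_nonneg_left (h2 i) (hy i)
      rw [← Finset.sum_mul, b.sum_coord_apply_eq_one, one_mul] at h3
      have := (abs_lt.1 hyV.2).2
      linarith

theorem exists_liftedHull_ge_upperHull_of_isCompact (hC : Convex ℝ C) (hf : ∀ y ∈ C, |f y| ≤ M)
    {K : Set E} (hK : IsCompact K) (hKC : K ⊆ interior C) {ε : ℝ} (hε : 0 < ε) :
    ∃ P : Finset E, (P : Set E) ⊆ C ∧
      ∀ y ∈ K, ∃ s, (y, s) ∈ liftedHull P f ∧ upperHull C f y - ε ≤ s := by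
  classical
  refine hK.induction_on (p := fun K => ∃ P : Finset E, (P : Set E) ⊆ C ∧
      ∀ y ∈ K, ∃ s, (y, s) ∈ liftedHull P f ∧ upperHull C f y - ε ≤ s) ?_ ?_ ?_ ?_
  · exact ⟨∅, by simp, by simp⟩
  · rintro S T hST ⟨P, hP, h⟩
    exact ⟨P, hP, fun y hy => h y (hST hy)⟩
  · rintro S T ⟨P, hP, h⟩ ⟨Q, hQ, h'⟩
    refine ⟨P ∪ Q, by simp [hP, hQ], fun y hy => ?_⟩
    rcases hy with hy | hy
    · obtain ⟨s, hs, hs'⟩ := h y hy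
      exact ⟨s, liftedHull_mono Finset.subset_union_left f hs, hs'⟩
    · obtain ⟨s, hs, hs'⟩ := h' y hy
      exact ⟨s, liftedHull_mono Finset.subset_union_right f hs, hs'⟩
  · intro x hx
    obtain ⟨U, hU, P, hP⟩ := exists_liftedHull_ge_upperHull_nhds hC hf (hKC hx) hε
    exact ⟨U, mem_nhdsWithin_of_mem_nhds hU, P, hP⟩

/-- Concavity gives continuity on the interior, and the frontier of a convex set is null. -/
theorem integrableOn_upperHull [MeasurableSpace E] [BorelSpace E] {μ : Measure E}
    [μ.IsAddHaarMeasure] (hC : IsCompact C) (hCconv : Convex ℝ C) (hf : ∀ y ∈ C, |f y| ≤ M) :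
    IntegrableOn (upperHull C f) C μ := by
  have hf' : ∀ y ∈ C, f y ≤ M := fun y hy => (abs_le.1 (hf y hy)).2
  refine integrableOn_of_aemeasurable_of_abs_le (M := M) hC (fun y hy => abs_le.2 ⟨?_, ?_⟩) ?_
  · exact (abs_le.1 (hf y hy)).1.trans (le_upperHull hCconv hf' hy)
  · exact upperHull_le (concaveOn_const M hCconv) hf' hy
  · have hae : (C : Set E) =ᵐ[μ] interior C :=
      (interior_ae_eq_of_null_frontier (hCconv.addHaar_frontier μ)).symm
    rw [Measure.restrict_congr_set hae]
    exact (concaveOn_upperHull hCconv hf').continuousOn_interior.aemeasurable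
      isOpen_interior.measurableSet

end UpperHull

/-! ### The inequality for integrable majorants -/

section Inequality

variable {k : ℕ} {C : Set (EuclideanSpace ℝ (Fin k))} {f g : EuclideanSpace ℝ (Fin k) → ℝ}

theorem le_supConv_of_mem {M N : ℝ} (hf : ∀ x ∈ C, |f x| ≤ M) (hg : ∀ x ∈ C, |g x| ≤ N)
    {x y : EuclideanSpace ℝ (Fin k)} (hx : x ∈ C) (hy : y ∈ C) :
    (f x + g y) / 2 ≤ supConv C f g ((1 / 2 : ℝ) • (x + y)) := by
  refine le_csSup ⟨(M + N) / 2, ?_⟩ ⟨x, hx, y, hy, rfl, rfl⟩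
  rintro _ ⟨x', hx', y', hy', -, rfl⟩
  have h1 := (abs_le.1 (hf x' hx')).2
  have h2 := (abs_le.1 (hg y' hy')).2
  linarith

/-- The integrable function `φ + (f + g) / 2` replaces the possibly non-measurable `f * g`. -/
theorem integral_upperHull_sub_le (hk : HasMidpointDissection k) (hC : IsCompact C)
    (hCconv : Convex ℝ C) {M N : ℝ} (hf : ∀ x ∈ C, |f x| ≤ M) (hg : ∀ x ∈ C, |g x| ≤ N)
    (hfm : AEMeasurable f (volume.restrict C)) (hgm : AEMeasurable g (volume.restrict C))
    {φ : EuclideanSpace ℝ (Fin k) → ℝ} (hφ : IntegrableOn φ C)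
    (hle : ∀ x ∈ C, supConv C f g x - (f x + g x) / 2 ≤ φ x) :
    ((k : ℝ) + 1) / 2 ^ (k + 1) * ∫ x in C, (upperHull C f x - f x) ≤ ∫ x in C, φ x := by
  rcases C.eq_empty_or_nonempty with rfl | ⟨x₀, hx₀⟩
  · simp
  have hM : 0 ≤ M := (abs_nonneg _).trans (hf x₀ hx₀)
  have hf' : ∀ y ∈ C, f y ≤ M := fun y hy => (abs_le.1 (hf y hy)).2
  have hfint := integrableOn_of_aemeasurable_of_abs_le hC hf hfm
  have hgint := integrableOn_of_aemeasurable_of_abs_le hC hg hgm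
  have hDint : IntegrableOn (fun x => upperHull C f x - f x) C :=
    (integrableOn_upperHull hC hCconv hf).sub hfint
  have hψint : IntegrableOn (fun x => φ x + (f x + g x) / 2) C :=
    hφ.add ((hfint.add hgint).div_const 2)
  have hmid : ∀ x ∈ C, ∀ y ∈ C, (f x + g y) / 2 ≤
      (fun x => φ x + (f x + g x) / 2) ((1 / 2 : ℝ) • (x + y)) := by
    intro x hx y hy
    have hz : (1 / 2 : ℝ) • (x + y) ∈ C := by
      rw [smul_add]
      exact hCconv hx hy (by norm_num) (by norm_num) (by norm_num)
    have h1 := hle _ hz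
    have h2 := le_supConv_of_mem hf hg hx hy
    simp only
    linarith
  have hc : (0 : ℝ) ≤ ((k : ℝ) + 1) / 2 ^ (k + 1) := by positivity
  have hmain : ∀ ε : ℝ, 0 < ε → ((k : ℝ) + 1) / 2 ^ (k + 1) *
      ((∫ x in C, (upperHull C f x - f x)) - (2 * volume.real C + 4 * M) * ε) ≤
        ∫ x in C, φ x := by
    intro ε hε
    obtain ⟨K, hKC, hK, hKvol⟩ := (isOpen_interior (s := C)).measurableSet.exists_isCompact_sdiff_lt
      ((measure_mono interior_subset).trans_lt (hC.measure_lt_top (μ := volume))).ne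
      (ENNReal.ofReal_pos.2 hε).ne'
    obtain ⟨P, hPC, hP⟩ := exists_liftedHull_ge_upperHull_of_isCompact hCconv hf hK hKC hε
    obtain ⟨t, ht, htgen⟩ := exists_isGenericHeight P f hε
    have hKm := hK.isClosed.measurableSet
    -- One `ε` pays for the finite hull, the other for lowering the heights. Off `K`, where `co f -
    -- f ≤ 2 * M`, the term `4 * M` brings `θ` down to `-2 * M - 2 * ε`, below the crude bound `ℓ -
    -- f ≥ -2 * M - ε` on the hull of `P`.
    let θ : EuclideanSpace ℝ (Fin k) → ℝ := fun x =>
      (upperHull C f x - f x) - (2 * ε + Kᶜ.indicator (fun _ => 4 * M) x)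
    have hconst : IntegrableOn (fun _ => 2 * ε) C := integrableOn_const hC.measure_lt_top.ne
    have hind : IntegrableOn (Kᶜ.indicator fun _ => 4 * M) C :=
      (integrableOn_const hC.measure_lt_top.ne).indicator hKm.compl
    have hcorr : IntegrableOn (fun x => 2 * ε + Kᶜ.indicator (fun _ => 4 * M) x) C :=
      hconst.add hind
    have hθ : IntegrableOn θ C := hDint.sub hcorr
    have hlift : ∀ ℓ : EuclideanSpace ℝ (Fin k) →ᵃ[ℝ] ℝ, (∀ p ∈ P, t p ≤ ℓ p) →
        ∀ q ∈ liftedHull P f, q.2 ≤ ℓ q.1 + ε := by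
      intro ℓ hℓ q hq
      refine le_of_mem_liftedHull (ℓ := ℓ + AffineMap.const ℝ _ ε) (fun p hp => ?_) hq
      have h1 := hℓ p hp
      have h2 := (ht p hp).1
      simp only [AffineMap.coe_add, Pi.add_apply, AffineMap.const_apply]
      linarith
    have hPC' : convexHull ℝ (P : Set (EuclideanSpace ℝ (Fin k))) ⊆ C :=
      convexHull_min hPC hCconv
    have hKP : K ⊆ convexHull ℝ (P : Set (EuclideanSpace ℝ (Fin k))) := by
      intro x hx
      obtain ⟨s, hs, -⟩ := hP x hx
      rw [← fst_image_liftedHull P f]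
      exact ⟨_, hs, rfl⟩
    have hoff : ∀ x ∈ C, x ∉ K → θ x ≤ -(2 * M + 2 * ε) := by
      intro x hx hxK
      have h1 := upperHull_le (concaveOn_const M hCconv) hf' hx
      have h2 := (abs_le.1 (hf x hx)).1
      simp only [θ, indicator_of_mem (mem_compl hxK)]
      linarith
    have key := polyhedral_supConv_inequality hk hC hCconv hfint hgint hψint hθ hmid hPC
      (fun p hp => (ht p hp).2) htgen (fun x hx ℓ hℓ => ?_) (fun x hx hxP => ?_)
    · have hcancel : ∀ x, φ x + (f x + g x) / 2 - (f x + g x) / 2 = φ x := fun x => by ring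
      simp only [hcancel] at key
      refine le_trans (mul_le_mul_of_nonneg_left ?_ hc) key
      simp only [θ]
      rw [integral_sub hDint hcorr, integral_add hconst hind, setIntegral_indicator hKm.compl, setIntegral_const, setIntegral_const,
        smul_eq_mul, smul_eq_mul]
      have hvol : volume.real (C ∩ Kᶜ) ≤ ε := by
        refine ENNReal.toReal_le_of_le_ofReal hε.le ?_
        refine le_trans (le_of_eq (measure_congr ?_)) hKvol.le
        exact (interior_ae_eq_of_null_frontier (hCconv.addHaar_frontier volume)).symm.inter
          Filter.EventuallyEq.rfl
      nlinarith [mul_le_mul_of_nonneg_right hvol hM]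
    · by_cases hxK : x ∈ K
      · obtain ⟨s, hs, hs'⟩ := hP x hxK
        have h1 := hlift ℓ hℓ _ hs
        simp only at h1
        simp only [θ, indicator_of_notMem (notMem_compl_iff.2 hxK)]
        linarith
      · have h1 := hoff x (hPC' hx) hxK
        have hx' := hx
        -- Constant heights `-M` lie below `ℓ + ε` on `P`, because `-M ≤ f p ≤ t p + ε`; hence `ℓ ≥
        -- -M - ε` on the whole hull.
        rw [← fst_image_liftedHull P (fun _ => -M)] at hx'
        obtain ⟨⟨y, s⟩, hq, rfl⟩ := hx'
        have h2 : -M - ε ≤ ℓ y := by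
          have hqM : -M ≤ s := by
            refine convexHull_min (t := {q : EuclideanSpace ℝ (Fin k) × ℝ | -M ≤ q.2}) ?_ ?_ hq
            · rintro _ ⟨p, hp, rfl⟩
              exact le_refl (-M)
            · exact convex_halfSpace_ge (LinearMap.snd ℝ _ ℝ).isLinear _
          have := le_of_mem_liftedHull (ℓ := ℓ + AffineMap.const ℝ _ ε) (fun p hp => ?_) hq
          · simp only [AffineMap.coe_add, Pi.add_apply, AffineMap.const_apply] at this
            linarith
          · have h1 := hℓ p hp
            have h2 := (ht p hp).1
            have h3 := (abs_le.1 (hf p (hPC hp))).1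
            simp only [AffineMap.coe_add, Pi.add_apply, AffineMap.const_apply]
            linarith
        have h3 := hf' y (hPC' hx)
        simp only at h1 h2 h3 ⊢
        linarith
    · have h1 := hoff x hx fun h => hxP (hKP h)
      linarith
  refine le_of_forall_pos_le_add fun δ hδ => ?_
  set B := ((k : ℝ) + 1) / 2 ^ (k + 1) * (2 * volume.real C + 4 * M) with hB
  have hB0 : 0 ≤ B := mul_nonneg hc (by positivity)
  -- The `+ 1` avoids division by zero when `B = 0`.
  have h1 := hmain (δ / (B + 1)) (by positivity)
  have h2 : B * (δ / (B + 1)) ≤ δ := by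
    rw [mul_div_assoc', div_le_iff₀ (by positivity)]
    nlinarith
  rw [mul_sub, ← mul_assoc, ← hB] at h1
  linarith

end Inequality

/-! ### Passage to the upper integral -/

section UpperIntegral

variable {k : ℕ} {C : Set (EuclideanSpace ℝ (Fin k))} {f g : EuclideanSpace ℝ (Fin k) → ℝ}

theorem mul_integral_upperHull_sub_le_upperIntegral (hk : HasMidpointDissection k)
    (hC : IsCompact C) (hCconv : Convex ℝ C) {M N : ℝ} (hf : ∀ x ∈ C, |f x| ≤ M)
    (hg : ∀ x ∈ C, |g x| ≤ N) (hfm : AEMeasurable f (volume.restrict C))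
    (hgm : AEMeasurable g (volume.restrict C)) :
    ((k : ℝ) + 1) / 2 ^ (k + 1) * ∫ x in C, (upperHull C f x - f x) ≤
      upperIntegral C (fun x => supConv C f g x - (f x + g x) / 2) := by
  -- The constant majorant makes the set nonempty; the real `sInf` of the empty set would be `0`.
  refine le_csInf ⟨_, fun _ => M + N, integrableOn_const hC.measure_lt_top.ne,
    fun x hx => ?_, rfl⟩ ?_
  · have h1 := (abs_le.1 (hf x hx)).1
    have h2 := (abs_le.1 (hg x hx)).1
    have h3 : supConv C f g x ≤ (M + N) / 2 := by
      refine csSup_le ⟨_, x, hx, x, hx, by rw [← two_smul ℝ x, smul_smul]; norm_num, rfl⟩ ?_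
      rintro _ ⟨y, hy, z, hz, -, rfl⟩
      linarith [(abs_le.1 (hf y hy)).2, (abs_le.1 (hg z hz)).2]
    simp only
    linarith
  · rintro _ ⟨φ, hφ, hle, rfl⟩
    exact integral_upperHull_sub_le hk hC hCconv hf hg hfm hgm hφ hle

theorem upperIntegral_supConv_le (hk : HasMidpointDissection k)
    (hC : IsCompact C) (hCconv : Convex ℝ C) {M N : ℝ} (hf : ∀ x ∈ C, |f x| ≤ M)
    (hg : ∀ x ∈ C, |g x| ≤ N) (hfm : AEMeasurable f (volume.restrict C))
    (hgm : AEMeasurable g (volume.restrict C))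
    {φ : EuclideanSpace ℝ (Fin k) → ℝ} (hφ : IntegrableOn φ C)
    (hle : ∀ x ∈ C, supConv C f g x - (f x + g x) / 2 ≤ φ x) :
    upperIntegral C (fun x => supConv C f g x - (f x + g x) / 2) ≤ ∫ x in C, φ x := by
  -- The inequality just proved supplies the lower bound that a real `sInf` needs.
  refine csInf_le ⟨((k : ℝ) + 1) / 2 ^ (k + 1) * ∫ x in C, (upperHull C f x - f x), ?_⟩
    ⟨φ, hφ, hle, rfl⟩
  rintro _ ⟨φ', hφ', hle', rfl⟩
  exact integral_upperHull_sub_le hk hC hCconv hf hg hfm hgm hφ' hle'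

end UpperIntegral

/-! ### Equality for vertex indicators of simplices -/

section Sharpness

variable {k : ℕ} (T : Affine.Simplex ℝ (EuclideanSpace ℝ (Fin k)) k)

theorem vertexIndicator_nonneg (x : EuclideanSpace ℝ (Fin k)) : 0 ≤ vertexIndicator T x :=
  indicator_nonneg (fun _ _ => zero_le_one) x

theorem vertexIndicator_le_one (x : EuclideanSpace ℝ (Fin k)) : vertexIndicator T x ≤ 1 :=
  indicator_le_self' (fun _ _ => zero_le_one) x

/-- For a concave majorant `h`, the set `{h ≥ 1}` is convex and contains the vertices, hence the
whole simplex. -/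
theorem upperHull_vertexIndicator {x : EuclideanSpace ℝ (Fin k)}
    (hx : x ∈ convexHull ℝ (range T.points)) :
    upperHull (convexHull ℝ (range T.points)) (vertexIndicator T) x = 1 := by
  refine le_antisymm (upperHull_le (concaveOn_const 1 (convex_convexHull ℝ _))
    (fun y _ => vertexIndicator_le_one T y) hx) (le_upperHull_of_forall (convex_convexHull ℝ _)
    (fun y _ => vertexIndicator_le_one T y) fun h hh hle => ?_)
  refine (convexHull_min ?_ (hh.convex_ge 1) hx).2
  rintro _ ⟨i, rfl⟩
  have hi := subset_convexHull ℝ _ (mem_range_self (f := T.points) i)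
  refine ⟨hi, (hle _ hi).trans' ?_⟩
  rw [vertexIndicator, indicator_of_mem (mem_range_self i)]

/-- Finite sets are null only for `k ≥ 1`; in dimension `0` a point has positive volume. -/
theorem vertexIndicator_ae_eq_zero (hk : 1 ≤ k) : vertexIndicator T =ᵐ[volume] 0 := by
  have : Nonempty (Fin k) := ⟨⟨0, hk⟩⟩
  have : Nontrivial (EuclideanSpace ℝ (Fin k)) := inferInstance
  exact indicator_meas_zero ((finite_range T.points).measure_zero volume)

theorem integral_upperHull_sub_vertexIndicator (hk : 1 ≤ k) :
    ∫ x in convexHull ℝ (range T.points),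
      (upperHull (convexHull ℝ (range T.points)) (vertexIndicator T) x - vertexIndicator T x) =
      volume.real (convexHull ℝ (range T.points)) := by
  have hm : MeasurableSet (convexHull ℝ (range T.points)) :=
    ((finite_range T.points).isCompact_convexHull ℝ).measurableSet
  have : ∫ x in convexHull ℝ (range T.points),
      (upperHull (convexHull ℝ (range T.points)) (vertexIndicator T) x - vertexIndicator T x) =
      ∫ x in convexHull ℝ (range T.points), (1 : ℝ) := by
    refine setIntegral_congr_ae hm ?_
    filter_upwards [vertexIndicator_ae_eq_zero T hk] with x hx hxC
    rw [upperHull_vertexIndicator T hxC, hx]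
    simp
  rw [this, setIntegral_const, smul_eq_mul, mul_one]

theorem volume_real_convexHull_simplex_pos :
    0 < volume.real (convexHull ℝ (range T.points)) := by
  have hspan : affineSpan ℝ (range T.points) = ⊤ :=
    T.independent.affineSpan_eq_top_iff_card_eq_finrank_add_one.2 (by simp)
  have hpos : 0 < volume (convexHull ℝ (range T.points)) :=
    (isOpen_interior.measure_pos volume
      (interior_convexHull_nonempty_iff_affineSpan_eq_top.2 hspan)).trans_le
      (measure_mono interior_subset)
  exact ENNReal.toReal_pos hpos.ne'
    ((finite_range T.points).isCompact_convexHull ℝ).measure_lt_top.ne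

/-- The union of the half-size copies of a simplex at its vertices. -/
noncomputable def cornerRegion : Set (EuclideanSpace ℝ (Fin k)) :=
  ⋃ i, AffineMap.homothety (T.points i) (1 / 2 : ℝ) '' convexHull ℝ (range T.points)

theorem measurableSet_cornerRegion : MeasurableSet (cornerRegion T) :=
  MeasurableSet.iUnion fun i =>
    (((finite_range T.points).isCompact_convexHull ℝ).image
      (AffineMap.homothety (T.points i) (1 / 2 : ℝ)).continuous_of_finiteDimensional).measurableSet

theorem volume_real_cornerRegion_le :
    volume.real (cornerRegion T) ≤
      ((k : ℝ) + 1) / 2 ^ k * volume.real (convexHull ℝ (range T.points)) := by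
  have h1 := measureReal_iUnion_fintype_le (μ := volume) fun i =>
    AffineMap.homothety (T.points i) (1 / 2 : ℝ) '' convexHull ℝ (range T.points)
  refine h1.trans (le_of_eq ?_)
  simp only [measureReal_def, Measure.addHaar_image_homothety, ENNReal.toReal_mul]
  simp [abs_of_pos]
  field_simp

/-- A pair with one vertex has its midpoint in a corner copy and value `1 / 2`; a pair of vertices
has value `1` but only finitely many midpoints; any other pair has value `0`. -/
theorem supConv_vertexIndicator_sub_le {x : EuclideanSpace ℝ (Fin k)}
    (hx : x ∈ convexHull ℝ (range T.points)) :
    supConv (convexHull ℝ (range T.points)) (vertexIndicator T) (vertexIndicator T) x -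
      (vertexIndicator T x + vertexIndicator T x) / 2 ≤
      (cornerRegion T).indicator (fun _ => 1 / 2) x +
        (range fun p : Fin (k + 1) × Fin (k + 1) =>
          (1 / 2 : ℝ) • (T.points p.1 + T.points p.2)).indicator (fun _ => 1) x := by
  have h0 := vertexIndicator_nonneg T x
  set W := (cornerRegion T).indicator (fun _ => (1 / 2 : ℝ)) x with hW
  set F := (range fun p : Fin (k + 1) × Fin (k + 1) =>
    (1 / 2 : ℝ) • (T.points p.1 + T.points p.2)).indicator (fun _ => (1 : ℝ)) x with hF
  have hW0 : 0 ≤ W := indicator_nonneg (fun _ _ => by norm_num) x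
  have hF0 : 0 ≤ F := indicator_nonneg (fun _ _ => by norm_num) x
  have hcorner : ∀ i, ∀ y ∈ convexHull ℝ (range T.points),
      (1 / 2 : ℝ) • (T.points i + y) = x → W = 1 / 2 := by
    intro i y hy hxy
    have hmem : x ∈ cornerRegion T := by
      refine mem_iUnion.2 ⟨i, y, hy, ?_⟩
      rw [← hxy, AffineMap.homothety_apply]
      simp only [vsub_eq_sub, vadd_eq_add]
      module
    rw [hW, indicator_of_mem hmem]
  suffices supConv (convexHull ℝ (range T.points)) (vertexIndicator T) (vertexIndicator T) x ≤
      W + F by linarith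
  refine csSup_le ⟨_, x, hx, x, hx, by rw [← two_smul ℝ x, smul_smul]; norm_num, rfl⟩ ?_
  rintro _ ⟨y, hy, z, hz, hyz, rfl⟩
  by_cases hyv : y ∈ range T.points
  · obtain ⟨i, rfl⟩ := hyv
    by_cases hzv : z ∈ range T.points
    · obtain ⟨j, rfl⟩ := hzv
      have hmem : x ∈ range fun p : Fin (k + 1) × Fin (k + 1) =>
          (1 / 2 : ℝ) • (T.points p.1 + T.points p.2) := ⟨(i, j), hyz⟩
      have : F = 1 := by rw [hF, indicator_of_mem hmem]
      linarith [vertexIndicator_le_one T (T.points i), vertexIndicator_le_one T (T.points j)]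
    · have h1 := hcorner i z hz hyz
      have h2 : vertexIndicator T z = 0 := indicator_of_notMem hzv _
      linarith [vertexIndicator_le_one T (T.points i)]
  · have h1 : vertexIndicator T y = 0 := indicator_of_notMem hyv _
    by_cases hzv : z ∈ range T.points
    · obtain ⟨j, rfl⟩ := hzv
      have h2 := hcorner j y hy (by rw [add_comm]; exact hyz)
      linarith [vertexIndicator_le_one T (T.points j)]
    · have h2 : vertexIndicator T z = 0 := indicator_of_notMem hzv _
      linarith

theorem upperIntegral_vertexIndicator (hk : HasMidpointDissection k) (hk1 : 1 ≤ k) :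
    upperIntegral (convexHull ℝ (range T.points))
      (fun x => supConv (convexHull ℝ (range T.points)) (vertexIndicator T) (vertexIndicator T) x -
        (vertexIndicator T x + vertexIndicator T x) / 2) =
      ((k : ℝ) + 1) / 2 ^ (k + 1) * ∫ x in convexHull ℝ (range T.points),
        (upperHull (convexHull ℝ (range T.points)) (vertexIndicator T) x -
          vertexIndicator T x) := by
  have hC : IsCompact (convexHull ℝ (range T.points)) :=
    (finite_range T.points).isCompact_convexHull ℝ
  have hconv : Convex ℝ (convexHull ℝ (range T.points)) := convex_convexHull ℝ _
  have hb : ∀ x ∈ convexHull ℝ (range T.points), |vertexIndicator T x| ≤ 1 := fun x _ => by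
    rw [abs_of_nonneg (vertexIndicator_nonneg T x)]
    exact vertexIndicator_le_one T x
  have hm : AEMeasurable (vertexIndicator T)
      (volume.restrict (convexHull ℝ (range T.points))) :=
    (measurable_const.indicator (finite_range T.points).measurableSet).aemeasurable
  refine le_antisymm ?_
    (mul_integral_upperHull_sub_le_upperIntegral hk hC hconv hb hb hm hm)
  let F := range fun p : Fin (k + 1) × Fin (k + 1) =>
    (1 / 2 : ℝ) • (T.points p.1 + T.points p.2)
  have hFm : MeasurableSet F := (finite_range _).measurableSet
  have hW : IntegrableOn ((cornerRegion T).indicator fun _ => (1 / 2 : ℝ))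
      (convexHull ℝ (range T.points)) :=
    (integrableOn_const hC.measure_lt_top.ne).indicator (measurableSet_cornerRegion T)
  have hF : IntegrableOn (F.indicator fun _ => (1 : ℝ)) (convexHull ℝ (range T.points)) :=
    (integrableOn_const hC.measure_lt_top.ne).indicator hFm
  refine (upperIntegral_supConv_le hk hC hconv hb hb hm hm (hW.add hF)
    fun x hx => supConv_vertexIndicator_sub_le T hx).trans ?_
  have : Nonempty (Fin k) := ⟨⟨0, hk1⟩⟩
  have hF0 : volume (convexHull ℝ (range T.points) ∩ F) = 0 :=
    measure_mono_null inter_subset_right ((finite_range _).measure_zero volume)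
  have hle : volume.real (convexHull ℝ (range T.points) ∩ cornerRegion T) ≤
      volume.real (cornerRegion T) := by
    refine measureReal_mono inter_subset_right (ne_of_lt ?_)
    refine (isCompact_iUnion fun i => hC.image
      (AffineMap.homothety (T.points i) (1 / 2 : ℝ)).continuous_of_finiteDimensional).measure_lt_top
  have h2 := volume_real_cornerRegion_le T
  rw [integral_upperHull_sub_vertexIndicator T hk1]
  simp only [Pi.add_apply]
  rw [integral_add hW hF, setIntegral_indicator (measurableSet_cornerRegion T),
    setIntegral_indicator hFm, setIntegral_const, setIntegral_const, measureReal_def (s := _ ∩ F),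
    hF0, ENNReal.toReal_zero, zero_smul, add_zero, smul_eq_mul, pow_succ]
  have h3 : ((k : ℝ) + 1) / (2 ^ k * 2) * volume.real (convexHull ℝ (range T.points)) =
      ((k : ℝ) + 1) / 2 ^ k * volume.real (convexHull ℝ (range T.points)) * (1 / 2) := by
    field_simp
  rw [h3]
  exact mul_le_mul_of_nonneg_right (hle.trans h2) (by norm_num)

end Sharpness

theorem mainTheorem2 (k : ℕ) (hk : k ≤ 3) :
    (∀ (C : Set (EuclideanSpace ℝ (Fin k))) (f g : EuclideanSpace ℝ (Fin k) → ℝ),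
      IsCompact C → Convex ℝ C →
      AEMeasurable f (volume.restrict C) → AEMeasurable g (volume.restrict C) →
      (∃ M : ℝ, ∀ x ∈ C, |f x| ≤ M) → (∃ M : ℝ, ∀ x ∈ C, |g x| ≤ M) →
        IntegrableOn (fun x => upperHull C f x - f x) C ∧
        ((k : ℝ) + 1) / 2 ^ (k + 1) * ∫ x in C, (upperHull C f x - f x) ≤
          upperIntegral C (fun x => supConv C f g x - (f x + g x) / 2)) ∧
    (1 ≤ k → ∀ (T : Affine.Simplex ℝ (EuclideanSpace ℝ (Fin k)) k)
      (C : Set (EuclideanSpace ℝ (Fin k))) (f : EuclideanSpace ℝ (Fin k) → ℝ),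
      C = convexHull ℝ (range T.points) → f = vertexIndicator T →
        (0 < ∫ x in C, (upperHull C f x - f x)) ∧
        upperIntegral C (fun x => supConv C f f x - (f x + f x) / 2) =
          ((k : ℝ) + 1) / 2 ^ (k + 1) * ∫ x in C, (upperHull C f x - f x)) := by
  have hdis := hasMidpointDissection_of_le_three hk
  refine ⟨?_, ?_⟩
  · rintro C f g hC hconv hfm hgm ⟨M, hf⟩ ⟨N, hg⟩
    exact ⟨(integrableOn_upperHull hC hconv hf).sub
      (integrableOn_of_aemeasurable_of_abs_le hC hf hfm),
      mul_integral_upperHull_sub_le_upperIntegral hdis hC hconv hf hg hfm hgm⟩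
  · rintro hk1 T C f rfl rfl
    refine ⟨?_, upperIntegral_vertexIndicator T hdis hk1⟩
    rw [integral_upperHull_sub_vertexIndicator T hk1]
    exact volume_real_convexHull_simplex_pos T
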